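/- Let $\mathbb{K}$ be a field, $n\ge 2$, and let $P_n\subset R_{n+1}=\mathbb{K}[x_1,\dots,x_{n+1}]$ be the defining ideal of the rational normal curve of degree $n$, i.e. the ideal generated by the $2\times 2$ minors of $$T_n=\begin{bmatrix}x_1&x_2&\cdots&x_n\\ x_2&x_3&\cdots&x_{n+1}\end{bmatrix}.$$ Let $1=i_0<i_1<\dots<i_k=n+1$ (with $k\ge 1$), and let $\mathcal{M}$ be the monomial ideal with associated sequence $i_0<\dots<i_k$, i.e. the ideal generated by the monomials $x_vx_{r+1}$ with $1\le v<r\le n$ and $v+1\le i_j<r+1$ for some $j$, and the monomials $x_{v+1}x_r$ with $1\le v<r\le n$ and $i_j<v+1<r+1\le i_{j+1}$ for some $j$. (For $\mathbb{K}$ algebraically closed, these are, by a theorem of Conca, De Negri and Rossi, exactly the Cohen–Macaulay initial monomial ideals of $P_n$.) A *parcycle* $(C,\Pi)$ is a cycle graph $C$ with a partition $\Pi$ of its vertex set $V$ into non-empty sets inducing connected subgraphs. Let $b_u\in\mathbb{Z}^V$ be the row of the Laplacian matrix of $C$ at the vertex $u$, and let $L_\Pi\subset\mathbb{Z}^V$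 be the lattice generated by the vectors $\sum_{u\in W}b_u$, $W\in\Pi$. The *toppling ideal* of $(C,\Pi)$ is $\langle \mathbf{x}^{\mathbf u}-\mathbf{x}^{\mathbf w}\mid \mathbf u,\mathbf w\in\mathbb{N}^V,\ \mathbf u-\mathbf w\in L_\Pi\rangle$. For a fixed $W_0\in\Pi$ (the sink), the *$G$-parking function ideal* is generated by the monomials $\mathbf{x}^{S\to\overline S}=\prod_{u\in S}x_u^{d_u}$, where $S$ runs over the unions of elements of $\Pi$ that induce a connected (non-empty) subgraph of $C$ and do not contain $W_0$, and $d_u$ is the number of edges from $u$ to $V\setminus S$. Let $C_{\Pi,\mathcal{M}}$ be the parcycle on $n+k$ vertices whose underlying cycle is, in cyclic order, $$s_2,\ i_1-1,\dots,i_0,\ v_0,\ i_2-1,\dots,i_1,\ v_1,\ \dots,\ i_{k-1}-1,\dots,i_{k-2},\ v_{k-2},\ n,n-1,\dots,i_{k-1}+1,\ s_1$$ (for $k=1$: $s_2,n,n-1,\dots,2,s_1$), with the partition consisting of $\{s_1,s_2\}$, the sets $\{i_r,v_r\}$ for $0\le r\le k-2$, and singletons. Let $\mathcal{S}=\mathbb{K}[x_1,\dots,x_{n+1},x_{v_0},\dots,x_{v_{k-2}},x_{s_1},x_{s_2}]$,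 let $I_{\Pi,\mathcal{M}}$ and $M_{\Pi,\mathcal{M}}$ be the ideals of $\mathcal{S}$ generated by the toppling ideal of $C_{\Pi,\mathcal{M}}$ and by its $G$-parking function ideal with sink $\{s_1,s_2\}$, and let $\mathcal{A}$ be the sequence consisting of $x_{v_j}-x_{i_{j+2}}$ $(0\le j\le k-2)$, $x_{s_1}-x_{i_{k-1}}$ and $x_{s_2}-x_{i_1}$. Let $\psi:\mathcal{S}\to R_{n+1}$ be the $\mathbb{K}$-algebra homomorphism with $x_p\mapsto x_p$, $x_{v_j}\mapsto x_{i_{j+2}}$, $x_{s_1}\mapsto x_{i_{k-1}}$, $x_{s_2}\mapsto x_{i_1}$. Then, with respect to the standard gradings (the rings below are graded by degree), $\bar f\otimes\bar g\mapsto\overline{\psi(f)\psi(g)}$ defines isomorphisms of graded $\mathbb{K}$-algebras, and of graded $R_{n+1}$-modules, $$\mathcal{S}/I_{\Pi,\mathcal{M}}\otimes_{\mathcal{S}}\mathcal{S}/\langle\mathcal{A}\rangle\;\simeq\;R_{n+1}/P_n,\qquad \mathcal{S}/M_{\Pi,\mathcal{M}}\otimes_{\mathcal{S}}\mathcal{S}/\langle\mathcal{A}\rangle\;\simeq\;R_{n+1}/\mathcal{M}.$$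 -/

import Mathlib

open scoped TensorProduct

/-! ## Parcycles, toppling ideals and parking function ideals -/

/-- A parcycle: a cycle graph together with a partition of its vertex set into nonempty subsets,
each of which induces a connected subgraph. -/
structure Parcycle (V : Type*) [Fintype V] [DecidableEq V] where
  graph : SimpleGraph V
  isCycle : ∃ m : ℕ, 3 ≤ m ∧ Nonempty (graph ≃g SimpleGraph.cycleGraph m)
  partition : Finpartition (Finset.univ : Finset V)
  connected : ∀ P ∈ partition.parts, (graph.induce (P : Set V)).Connected

/-- The lattice ideal of a sublattice `L` of `ℤ^V`. -/
noncomputable def latticeIdeal (K : Type*) [Field K] {V : Type*} (L : AddSubgroup (V → ℤ)) :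
    Ideal (MvPolynomial V K) :=
  Ideal.span {f | ∃ u v : V →₀ ℕ, (fun w => (u w : ℤ) - (v w : ℤ)) ∈ L ∧
    f = MvPolynomial.monomial u 1 - MvPolynomial.monomial v 1}

namespace Parcycle

variable {V : Type*} [Fintype V] [DecidableEq V]

open Classical in
/-- The row of the Laplacian matrix of the underlying cycle corresponding to the vertex `j`. -/
noncomputable def lapRow (C : Parcycle V) (j : V) : V → ℤ := fun w => C.graph.lapMatrix ℤ j w

/-- The lattice generated by the sums `b_P = ∑ j ∈ P, b_j` over the parts `P` of the partition. -/
noncomputable def laplacianLattice (C : Parcycle V) : AddSubgroup (V → ℤ) :=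
  AddSubgroup.closure {b | ∃ P ∈ C.partition.parts, b = ∑ j ∈ P, C.lapRow j}

/-- The toppling ideal of a parcycle. -/
noncomputable def topplingIdeal (K : Type*) [Field K] (C : Parcycle V) :
    Ideal (MvPolynomial V K) :=
  latticeIdeal K C.laplacianLattice

/-- A parset is a union of parts of the partition. -/
def IsParset (C : Parcycle V) (S : Finset V) : Prop :=
  ∃ U ⊆ C.partition.parts, S = U.biUnion id

/-- A connected parset (in particular, it is nonempty). -/
def IsConnectedParset (C : Parcycle V) (S : Finset V) : Prop :=
  C.IsParset S ∧ (C.graph.induce (S : Set V)).Connected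

open Classical in
/-- The monomial `∏ i ∈ S, x_i ^ d_i`, where `d_i` is the number of edges from `i` to the
complement of `S`. -/
noncomputable def cutMonomial (K : Type*) [Field K] (C : Parcycle V) (S : Finset V) :
    MvPolynomial V K :=
  ∏ i ∈ S, MvPolynomial.X i ^ (Finset.univ.filter fun j => j ∉ S ∧ C.graph.Adj i j).card

/-- The `G`-parking function ideal of a parcycle, with respect to the main vertex `sink`. -/
noncomputable def parkingIdeal (K : Type*) [Field K] (C : Parcycle V) (sink : Finset V) :
    Ideal (MvPolynomial V K) :=
  Ideal.span {f | ∃ S : Finset V, C.IsConnectedParset S ∧ ¬ sink ⊆ S ∧ f = C.cutMonomial K S}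

end Parcycle

/-! ## The rational normal curve -/

/-- The index set `{1, …, n + 1}` of the variables of `R_{n+1}`. -/
abbrev RIdx (n : ℕ) : Type := Finset.Icc 1 (n + 1)

/-- The polynomial ring `R_{n+1} = K[x_1, …, x_{n+1}]`. -/
abbrev RRing (K : Type*) [Field K] (n : ℕ) : Type _ := MvPolynomial (RIdx n) K

/-- The matrix `T_n` with rows `(x_1, …, x_n)` and `(x_2, …, x_{n+1})`. -/
noncomputable def hankelMatrix (K : Type*) [Field K] (n : ℕ) :
    Matrix (Fin 2) (Finset.Icc 1 n) (RRing K n) :=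
  Matrix.of ![
    fun c => MvPolynomial.X ⟨c.1, by have := Finset.mem_Icc.1 c.2; simp; omega⟩,
    fun c => MvPolynomial.X ⟨c.1 + 1, by have := Finset.mem_Icc.1 c.2; simp; omega⟩]

/-- The defining ideal `P_n` of the rational normal curve of degree `n`, generated by the `2 × 2`
minors of `T_n`. -/
noncomputable def rationalNormalIdeal (K : Type*) [Field K] (n : ℕ) : Ideal (RRing K n) :=
  Ideal.span {f | ∃ v r : Finset.Icc 1 n, v < r ∧
    f = ((hankelMatrix K n).submatrix id ![v, r]).det}

/-- A sequence `1 = i_0 < i_1 < ⋯ < i_k = n + 1` with `k ≥ 1`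
(only the values `i 0, …, i k` are ever used). -/
structure BreakSeq (n : ℕ) where
  k : ℕ
  k_pos : 1 ≤ k
  i : ℕ → ℕ
  i_zero : i 0 = 1
  i_last : i k = n + 1
  i_lt : ∀ r < k, i r < i (r + 1)

/-- The variables of the ring `S`: `x_1, …, x_{n+1}`, `x_{v_0}, …, x_{v_{k-2}}`,
`x_{s_1}`, `x_{s_2}`. -/
inductive SVar (n k : ℕ) : Type
  | x (p : RIdx n) : SVar n k
  | v (j : Fin (k - 1)) : SVar n k
  | s1 : SVar n k
  | s2 : SVar n k
  deriving DecidableEq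

namespace BreakSeq

variable {n : ℕ}

/-- The monomial ideal associated with the sequence `i_0 < ⋯ < i_k`: it is generated by
the main diagonals `x_v x_{r+1}` of the `2 × 2` minors of `T_n` with `v + 1 ≤ i_j < r + 1` for
some `j`, and the anti-diagonals `x_{v+1} x_r` with `i_j < v + 1 < r + 1 ≤ i_{j+1}` for some `j`. -/
noncomputable def monomialIdeal (K : Type*) [Field K] (T : BreakSeq n) : Ideal (RRing K n) :=
  Ideal.span
    ({f | ∃ v r : Finset.Icc 1 n, v < r ∧
        (∃ j ≤ T.k, v.1 + 1 ≤ T.i j ∧ T.i j < r.1 + 1) ∧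
        f = hankelMatrix K n 0 v * hankelMatrix K n 1 r} ∪
     {f | ∃ v r : Finset.Icc 1 n, v < r ∧
        (∃ j < T.k, T.i j < v.1 + 1 ∧ v.1 + 1 < r.1 + 1 ∧ r.1 + 1 ≤ T.i (j + 1)) ∧
        f = hankelMatrix K n 1 v * hankelMatrix K n 0 r})

lemma i_mono (T : BreakSeq n) {a b : ℕ} (hab : a ≤ b) (hb : b ≤ T.k) : T.i a ≤ T.i b := by
  induction b, hab using Nat.le_induction with
  | base => exact le_rfl
  | succ m hm ih => exact (ih (by omega)).trans (T.i_lt m (by omega)).le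

/-- `i_r` as an index of a variable of `R_{n+1}`. -/
def idx (T : BreakSeq n) (r : ℕ) (hr : r ≤ T.k) : RIdx n :=
  ⟨T.i r, by
    have h0 := T.i_mono (Nat.zero_le r) hr
    have h1 := T.i_mono hr le_rfl
    rw [T.i_zero] at h0
    rw [T.i_last] at h1
    exact Finset.mem_Icc.2 ⟨h0, h1⟩⟩

/-! ## The parcycle of a sequence -/

/-- `p` is (the label of) a vertex of type I. -/
def IsTypeI (T : BreakSeq n) (p : ℕ) : Prop := ∃ r < T.k, T.i r < p ∧ p < T.i (r + 1)

/-- The basic vertices of the parcycle: those of type I, those of type II, which are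
`i_0, v_0, …, i_{k-2}, v_{k-2}`, and `s_1, s_2`. -/
inductive IsVertex (T : BreakSeq n) : SVar n T.k → Prop
  | typeI (p : RIdx n) (hp : T.IsTypeI p.1) : T.IsVertex (.x p)
  | typeII (p : RIdx n) (r : ℕ) (hr : r + 2 ≤ T.k) (hp : p.1 = T.i r) : T.IsVertex (.x p)
  | v (j : Fin (T.k - 1)) : T.IsVertex (.v j)
  | s1 : T.IsVertex .s1
  | s2 : T.IsVertex .s2

/-- The edges of the cycle. The first two are the basic edges, the others the relevant edges. -/
inductive IsEdge (T : BreakSeq n) : SVar n T.k → SVar n T.k → Prop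
  | basic (p : RIdx n) (j : Fin (T.k - 1)) (hp : p.1 = T.i j) : T.IsEdge (.x p) (.v j)
  | sink : T.IsEdge .s1 .s2
  | s2 (p : RIdx n) (hp : p.1 + 1 = T.i 1) : T.IsEdge (.x p) .s2
  | s1_of_gap (p : RIdx n) (h : T.i (T.k - 1) + 2 ≤ T.i T.k) (hp : p.1 = T.i (T.k - 1) + 1) :
      T.IsEdge (.x p) .s1
  | s1_of_no_gap (j : Fin (T.k - 1)) (h : T.i T.k = T.i (T.k - 1) + 1) (hj : j.1 + 2 = T.k) :
      T.IsEdge (.v j) .s1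
  | typeI (p q : RIdx n) (hp : T.IsTypeI p.1) (hq : T.IsTypeI q.1) (h : p.1 = q.1 + 1) :
      T.IsEdge (.x p) (.x q)
  | down (p q : RIdx n) (r : ℕ) (hr : r + 2 ≤ T.k) (h : T.i r + 2 ≤ T.i (r + 1))
      (hp : p.1 = T.i r + 1) (hq : q.1 = T.i r) : T.IsEdge (.x p) (.x q)
  | next (j : Fin (T.k - 1)) (q : RIdx n) (hj : j.1 + 3 ≤ T.k) (hq : q.1 + 1 = T.i (j.1 + 2)) :
      T.IsEdge (.v j) (.x q)
  | next_last (j : Fin (T.k - 1)) (q : RIdx n) (hj : j.1 + 2 = T.k)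
      (h : T.i (T.k - 1) + 2 ≤ T.i T.k) (hq : q.1 + 1 = T.i T.k) : T.IsEdge (.v j) (.x q)

/-- The type of basic vertices. -/
abbrev Vertex (T : BreakSeq n) : Type := {w : SVar n T.k // T.IsVertex w}

instance (n k : ℕ) : Finite (SVar n k) :=
  Finite.of_surjective
    (fun z : RIdx n ⊕ Fin (k - 1) ⊕ Bool => match z with
      | .inl p => SVar.x p
      | .inr (.inl j) => SVar.v j
      | .inr (.inr true) => SVar.s1
      | .inr (.inr false) => SVar.s2)
    (fun w => match w with
      | .x p => ⟨.inl p, rfl⟩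
      | .v j => ⟨.inr (.inl j), rfl⟩
      | .s1 => ⟨.inr (.inr true), rfl⟩
      | .s2 => ⟨.inr (.inr false), rfl⟩)

noncomputable instance (T : BreakSeq n) : Fintype T.Vertex := Fintype.ofFinite _

/-- The underlying cycle of the parcycle. -/
def cycle (T : BreakSeq n) : SimpleGraph T.Vertex :=
  SimpleGraph.fromRel fun u w => T.IsEdge u.1 w.1

/-- Two basic vertices lie in the same main vertex if and only if they have the same image: the
main vertices are `{i_r, v_r}`, `{s_1, s_2}` and the singletons of type I. -/
def mainLabel (T : BreakSeq n) : SVar n T.k → SVar n T.k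
  | .x p => .x p
  | .v j => .x (T.idx j.1 (by have := j.2; omega))
  | .s1 => .s1
  | .s2 => .s1

open Classical in
/-- The partition of the basic vertices into main vertices. -/
noncomputable def partition (T : BreakSeq n) : Finpartition (Finset.univ : Finset T.Vertex) :=
  Finpartition.ofSetoid (Setoid.ker fun u : T.Vertex => T.mainLabel u.1)

/-! The underlying graph is a cycle: positions in the cyclic order
`s_2, i_1 - 1, …, i_0, v_0, i_2 - 1, …, i_1, v_1, …, v_{k-2}, n, …, i_{k-1} + 1, s_1`. -/

lemma exists_block (T : BreakSeq n) (p : ℕ) (h1 : 1 ≤ p) (h2 : p ≤ n) :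
    ∃ r < T.k, T.i r ≤ p ∧ p < T.i (r + 1) := by
  have key : ∀ m ≤ T.k, p < T.i m → ∃ r < m, T.i r ≤ p ∧ p < T.i (r + 1) := by
    intro m
    induction m with
    | zero => intro _ h; rw [T.i_zero] at h; omega
    | succ m ih =>
      intro hm h
      by_cases hp : T.i m ≤ p
      · exact ⟨m, by omega, hp, h⟩
      · obtain ⟨r, hr, h⟩ := ih (by omega) (by omega)
        exact ⟨r, by omega, h⟩
  exact key T.k le_rfl (by rw [T.i_last]; omega)

lemma block_unique (T : BreakSeq n) {p r s : ℕ} (hr : r < T.k) (hs : s < T.k)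
    (h1 : T.i r ≤ p) (h2 : p < T.i (r + 1)) (h3 : T.i s ≤ p) (h4 : p < T.i (s + 1)) : r = s := by
  by_contra hne
  rcases Nat.lt_or_gt_of_ne hne with h | h
  · have := T.i_mono (show r + 1 ≤ s by omega) (by omega); omega
  · have := T.i_mono (show s + 1 ≤ r by omega) (by omega); omega

/-- `w` has position `m` in the cyclic order. -/
def IsPos (T : BreakSeq n) : SVar n T.k → ℕ → Prop
  | .x p, m => ∃ r < T.k, T.i r ≤ p.1 ∧ p.1 < T.i (r + 1) ∧ m + p.1 + 1 = T.i r + T.i (r + 1) + r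
  | .v j, m => m = T.i (j.1 + 1) + j.1
  | .s1, m => m + 1 = n + T.k
  | .s2, m => m = 0

lemma isPos_fun (T : BreakSeq n) {w : SVar n T.k} {a b : ℕ} (ha : T.IsPos w a)
    (hb : T.IsPos w b) : a = b := by
  cases w with
  | x p =>
    obtain ⟨r, hr, h1, h2, h3⟩ := ha
    obtain ⟨s, hs, h4, h5, h6⟩ := hb
    obtain rfl := T.block_unique hr hs h1 h2 h4 h5
    omega
  | v j => simp only [IsPos] at ha hb; omega
  | s1 => simp only [IsPos] at ha hb; omega
  | s2 => simp only [IsPos] at ha hb; omega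

/-- A vertex `x_p` lies in a block and is not the last entry `i_{k-1}` of the last block. -/
lemma isVertex_x_iff (T : BreakSeq n) (p : RIdx n) :
    T.IsVertex (.x p) ↔ ∃ r < T.k, T.i r ≤ p.1 ∧ p.1 < T.i (r + 1) ∧
      (r + 1 = T.k → T.i r < p.1) := by
  constructor
  · intro h
    cases h with
    | typeI _ hp =>
      obtain ⟨r, hr, h1, h2⟩ := hp
      exact ⟨r, hr, h1.le, h2, fun _ => h1⟩
    | typeII _ r hr hp =>
      refine ⟨r, by omega, hp.ge, ?_, fun h => by omega⟩
      rw [hp]; exact T.i_lt r (by omega)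
  · rintro ⟨r, hr, h1, h2, h3⟩
    by_cases h : T.i r < p.1
    · exact .typeI p ⟨r, hr, h, h2⟩
    · exact .typeII p r (by by_contra hc; exact h (h3 (by omega))) (by omega)

lemma isPos_lt (T : BreakSeq n) (hn : 2 ≤ n) {w : SVar n T.k} {m : ℕ} (hm : T.IsPos w m) :
    m < n + T.k := by
  have hk := T.k_pos
  cases w with
  | x p =>
    obtain ⟨r, hr, h1, h2, h3⟩ := hm
    have := T.i_mono (show r + 1 ≤ T.k by omega) le_rfl
    rw [T.i_last] at this
    omega
  | v j =>
    have := j.2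
    have h := T.i_mono (show j.1 + 1 ≤ T.k by omega) le_rfl
    rw [T.i_last] at h
    simp only [IsPos] at hm
    omega
  | s1 => simp only [IsPos] at hm; omega
  | s2 => simp only [IsPos] at hm; omega

lemma exists_isPos (T : BreakSeq n) (hn : 2 ≤ n) {w : SVar n T.k} (hw : T.IsVertex w) :
    ∃ m, T.IsPos w m := by
  have hk := T.k_pos
  cases w with
  | x p =>
    obtain ⟨r, hr, h1, h2, -⟩ := (T.isVertex_x_iff p).1 hw
    exact ⟨T.i r + T.i (r + 1) + r - p.1 - 1, r, hr, h1, h2, by omega⟩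
  | v j => exact ⟨_, rfl⟩
  | s1 => exact ⟨n + T.k - 1, by simp only [IsPos]; omega⟩
  | s2 => exact ⟨0, rfl⟩

lemma isPos_inj (T : BreakSeq n) {u w : SVar n T.k} (hu : T.IsVertex u)
    (hw : T.IsVertex w) {m : ℕ} (hum : T.IsPos u m) (hwm : T.IsPos w m) : u = w := by
  have hk := T.k_pos
  have hl := T.i_last
  have h0 := T.i_zero
  have posx : ∀ p : RIdx n, T.IsVertex (.x p) → T.IsPos (.x p) m →
      ∃ r < T.k, T.i r ≤ p.1 ∧ p.1 < T.i (r + 1) ∧ m + p.1 + 1 = T.i r + T.i (r + 1) + r ∧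
        (r + 1 = T.k → T.i r < p.1) := by
    intro p hp hpm
    obtain ⟨r, hr, h1, h2, h3⟩ := (T.isVertex_x_iff p).1 hp
    obtain ⟨s, hs, h4, h5, h6⟩ := hpm
    obtain rfl := T.block_unique hr hs h1 h2 h4 h5
    exact ⟨r, hr, h1, h2, h6, h3⟩
  have xx : ∀ p q : RIdx n, T.IsPos (.x p) m → T.IsPos (.x q) m → p = q := by
    rintro p q ⟨r, hr, h1, h2, h3⟩ ⟨s, hs, h4, h5, h6⟩
    rcases Nat.lt_trichotomy r s with h | rfl | h
    · have := T.i_mono (show r + 1 ≤ s by omega) (by omega); omega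
    · exact Subtype.ext (by omega)
    · have := T.i_mono (show s + 1 ≤ r by omega) (by omega); omega
  have xv : ∀ (p : RIdx n) (j : Fin (T.k - 1)), T.IsPos (.x p) m → ¬ T.IsPos (.v j) m := by
    rintro p j ⟨r, hr, h1, h2, h3⟩ hj
    simp only [IsPos] at hj
    have hj2 := j.2
    rcases Nat.lt_or_ge j.1 r with h | h
    · have := T.i_mono (show j.1 + 1 ≤ r by omega) (by omega); omega
    · have := T.i_mono (show r + 1 ≤ j.1 + 1 by omega) (by omega); omega
  have xs1 : ∀ p : RIdx n, T.IsVertex (.x p) → T.IsPos (.x p) m → ¬ T.IsPos (.s1) m := by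
    intro p hp hpm hs
    obtain ⟨r, hr, h1, h2, h3, h4⟩ := posx p hp hpm
    simp only [IsPos] at hs
    have := T.i_mono (show r + 1 ≤ T.k by omega) le_rfl
    rcases Nat.lt_or_ge (r + 1) T.k with h | h
    · omega
    · have : r + 1 = T.k := by omega
      have h5 := h4 this
      rw [this] at h3 h2
      omega
  have xs2 : ∀ p : RIdx n, T.IsPos (.x p) m → ¬ T.IsPos (.s2) m := by
    rintro p ⟨r, hr, h1, h2, h3⟩ hs
    simp only [IsPos] at hs
    have := T.i_mono (show 0 ≤ r by omega) (by omega)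
    omega
  have vv : ∀ j l : Fin (T.k - 1), T.IsPos (.v j) m → T.IsPos (.v l) m → j = l := by
    intro j l hj hl
    simp only [IsPos] at hj hl
    have hj2 := j.2
    have hl2 := l.2
    rcases Nat.lt_trichotomy j.1 l.1 with h | h | h
    · have := T.i_mono (show j.1 + 1 ≤ l.1 + 1 by omega) (by omega); omega
    · exact Fin.ext h
    · have := T.i_mono (show l.1 + 1 ≤ j.1 + 1 by omega) (by omega); omega
  have vs1 : ∀ j : Fin (T.k - 1), T.IsPos (.v j) m → ¬ T.IsPos (.s1) m := by
    intro j hj hs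
    simp only [IsPos] at hj hs
    have hj2 := j.2
    have := T.i_mono (show j.1 + 1 + 1 ≤ T.k by omega) le_rfl
    have := T.i_lt (j.1 + 1) (by omega)
    omega
  have vs2 : ∀ j : Fin (T.k - 1), T.IsPos (.v j) m → ¬ T.IsPos (.s2) m := by
    intro j hj hs
    simp only [IsPos] at hj hs
    have hj2 := j.2
    have := T.i_mono (show 0 ≤ j.1 + 1 by omega) (by omega)
    rw [T.i_zero] at this
    omega
  have s12 : T.IsPos (.s1) m → ¬ T.IsPos (.s2) m := by
    intro hj hs
    simp only [IsPos] at hj hs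
    have h := T.i_mono (show 0 ≤ T.k by omega) le_rfl
    have := T.i_mono (show 1 ≤ T.k by omega) le_rfl
    have := T.i_lt 0 (by omega)
    simp only [zero_add] at this
    omega
  cases u <;> cases w
  case x.x p q => rw [xx p q hum hwm]
  case x.v p j => exact absurd hwm (xv p j hum)
  case x.s1 p => exact absurd hwm (xs1 p hu hum)
  case x.s2 p => exact absurd hwm (xs2 p hum)
  case v.x j p => exact absurd hum (xv p j hwm)
  case v.v j l => rw [vv j l hum hwm]
  case v.s1 j => exact absurd hwm (vs1 j hum)
  case v.s2 j => exact absurd hwm (vs2 j hum)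
  case s1.x p => exact absurd hum (xs1 p hw hwm)
  case s1.v j => exact absurd hum (vs1 j hwm)
  case s1.s1 => rfl
  case s1.s2 => exact absurd hwm (s12 hum)
  case s2.x p => exact absurd hum (xs2 p hwm)
  case s2.v j => exact absurd hum (vs2 j hwm)
  case s2.s1 => exact absurd hum (s12 hwm)
  case s2.s2 => rfl

/-- Consecutive in the cyclic order. -/
def Consec (N a b : ℕ) : Prop := a + 1 = b ∨ (b = 0 ∧ a + 1 = N)

lemma isEdge_consec (T : BreakSeq n) {u w : SVar n T.k}
    (h : T.IsEdge u w) {a b : ℕ} (ha : T.IsPos u a) (hb : T.IsPos w b) :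
    Consec (n + T.k) a b ∨ Consec (n + T.k) b a := by
  have hk := T.k_pos
  have hl := T.i_last
  have h0 := T.i_zero
  have blk : ∀ (p : RIdx n) (m r : ℕ), T.IsPos (.x p) m → r < T.k → T.i r ≤ p.1 →
      p.1 < T.i (r + 1) → m + p.1 + 1 = T.i r + T.i (r + 1) + r := by
    rintro p m r ⟨s, hs, h1, h2, h3⟩ hr h4 h5
    obtain rfl := T.block_unique hr hs h4 h5 h1 h2
    exact h3
  unfold Consec
  cases h with
  | basic p j hp =>
    have hj := j.2
    have h1 := T.i_lt j (by omega)
    have := blk p a j ha (by omega) (by omega) (by omega)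
    simp only [IsPos] at hb
    omega
  | sink => simp only [IsPos] at ha hb; omega
  | s2 p hp =>
    have h1 := T.i_lt 0 (by omega)
    rw [zero_add] at h1
    have := blk p a 0 ha (by omega) (by omega) (by rw [zero_add]; omega)
    rw [zero_add] at this
    simp only [IsPos] at hb
    omega
  | s1_of_gap p h hp =>
    have e : T.k - 1 + 1 = T.k := by omega
    have := blk p a (T.k - 1) ha (by omega) (by omega) (by rw [e]; omega)
    rw [e] at this
    simp only [IsPos] at hb
    omega
  | s1_of_no_gap j h hj =>
    simp only [IsPos] at ha hb
    have e : T.i (T.k - 1) = T.i (j.1 + 1) := congrArg T.i (by omega)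
    omega
  | typeI p q hp hq h =>
    obtain ⟨r, hr, h1, h2⟩ := hp
    obtain ⟨s, hs, h3, h4⟩ := hq
    obtain rfl := T.block_unique hs hr (by omega) h4 (show T.i r ≤ q.1 by omega) (by omega)
    have := blk p a s ha hr (by omega) (by omega)
    have := blk q b s hb hr (by omega) (by omega)
    omega
  | down p q r hr h hp hq =>
    have := blk p a r ha (by omega) (by omega) (by omega)
    have := blk q b r hb (by omega) (by omega) (by omega)
    omega
  | next j q hj hq =>
    have := T.i_lt (j.1 + 1) (by omega)
    have e : T.i (j.1 + 1 + 1) = T.i (j.1 + 2) := rfl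
    have := blk q b (j.1 + 1) hb (by omega) (by omega) (by omega)
    simp only [IsPos] at ha
    omega
  | next_last j q hj h hq =>
    have e : T.i (T.k - 1) = T.i (j.1 + 1) := congrArg T.i (by omega)
    have e' : T.i T.k = T.i (j.1 + 1 + 1) := congrArg T.i (by omega)
    rw [e] at h
    have := T.i_lt (j.1 + 1) (by omega)
    rw [e'] at h hq
    have := blk q b (j.1 + 1) hb (by omega) (by omega) (by omega)
    simp only [IsPos] at ha
    omega

lemma exists_next (T : BreakSeq n) (hn : 2 ≤ n) {u : SVar n T.k} (hu : T.IsVertex u) {m : ℕ}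
    (hm : T.IsPos u m) :
    ∃ w b, T.IsVertex w ∧ T.IsPos w b ∧ Consec (n + T.k) m b ∧ (T.IsEdge u w ∨ T.IsEdge w u) := by
  have hk := T.k_pos
  have hl := T.i_last
  have h0 := T.i_zero
  have mk : ∀ q, 1 ≤ q → q ≤ n + 1 → ∃ q' : RIdx n, q'.1 = q := fun q h1 h2 =>
    ⟨⟨q, Finset.mem_Icc.2 ⟨h1, h2⟩⟩, rfl⟩
  unfold Consec
  cases u with
  | x p =>
    obtain ⟨r, hr, h1, h2, h3⟩ := (T.isVertex_x_iff p).1 hu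
    obtain ⟨s, hs, h4, h5, h6⟩ := hm
    obtain rfl := T.block_unique hr hs h1 h2 h4 h5
    have hp := Finset.mem_Icc.1 p.2
    rcases Nat.lt_or_ge (r + 1) T.k with hrk | hrk
    · by_cases hpr : p.1 = T.i r
      · refine ⟨.v ⟨r, by omega⟩, _, .v _, rfl, Or.inl ?_, Or.inl (.basic p ⟨r, by omega⟩ hpr)⟩
        simp only
        omega
      · have := T.i_mono (show 0 ≤ r by omega) (by omega)
        obtain ⟨q, hq⟩ := mk (p.1 - 1) (by omega) (by omega)
        refine ⟨.x q, m + 1, (T.isVertex_x_iff q).2 ⟨r, hr, by omega, by omega, by omega⟩,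
          ⟨r, hr, by omega, by omega, by omega⟩, Or.inl rfl, Or.inl ?_⟩
        by_cases hqr : q.1 = T.i r
        · exact .down p q r (by omega) (by omega) (by omega) hqr
        · exact .typeI p q ⟨r, hr, by omega, by omega⟩ ⟨r, hr, by omega, by omega⟩ (by omega)
    · have e : r + 1 = T.k := by omega
      have er : T.k - 1 = r := by omega
      have hpr := h3 e
      by_cases hpr' : p.1 = T.i r + 1
      · refine ⟨.s1, n + T.k - 1, .s1, by simp only [IsPos]; omega, Or.inl ?_,
          Or.inl (.s1_of_gap p ?_ ?_)⟩
        · rw [e] at h6; omega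
        · rw [er, ← e]; omega
        · rw [er]; omega
      · have := T.i_mono (show 0 ≤ r by omega) (by omega)
        obtain ⟨q, hq⟩ := mk (p.1 - 1) (by omega) (by omega)
        refine ⟨.x q, m + 1, (T.isVertex_x_iff q).2 ⟨r, hr, by omega, by omega, by omega⟩,
          ⟨r, hr, by omega, by omega, by omega⟩, Or.inl rfl, Or.inl ?_⟩
        exact .typeI p q ⟨r, hr, by omega, by omega⟩ ⟨r, hr, by omega, by omega⟩ (by omega)
  | v j =>
    have hj := j.2
    simp only [IsPos] at hm
    have hlt := T.i_lt (j.1 + 1) (by omega)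
    have hmo := T.i_mono (show j.1 + 1 + 1 ≤ T.k by omega) le_rfl
    have hmo0 := T.i_mono (show 0 ≤ j.1 + 1 by omega) (by omega)
    rcases Nat.lt_or_ge (j.1 + 2) T.k with h | h
    · obtain ⟨q, hq⟩ := mk (T.i (j.1 + 1 + 1) - 1) (by omega) (by omega)
      refine ⟨.x q, m + 1, (T.isVertex_x_iff q).2 ⟨j.1 + 1, by omega, by omega, by omega, by omega⟩,
          ⟨j.1 + 1, by omega, by omega, by omega, by omega⟩, Or.inl rfl, Or.inl ?_⟩
      refine .next j q (by omega) ?_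
      change q.1 + 1 = T.i (j.1 + 1 + 1)
      omega
    · have e : T.i T.k = T.i (j.1 + 1 + 1) := congrArg T.i (by omega)
      have e' : T.i (T.k - 1) = T.i (j.1 + 1) := congrArg T.i (by omega)
      by_cases hg : T.i (j.1 + 1) + 2 ≤ T.i (j.1 + 1 + 1)
      · obtain ⟨q, hq⟩ := mk (T.i (j.1 + 1 + 1) - 1) (by omega) (by omega)
        refine ⟨.x q, m + 1,
          (T.isVertex_x_iff q).2 ⟨j.1 + 1, by omega, by omega, by omega, by omega⟩,
          ⟨j.1 + 1, by omega, by omega, by omega, by omega⟩, Or.inl rfl, Or.inl ?_⟩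
        refine .next_last j q (by omega) ?_ ?_
        · rw [e', e]; exact hg
        · rw [e]; omega
      · refine ⟨.s1, n + T.k - 1, .s1, by simp only [IsPos]; omega, Or.inl ?_,
          Or.inl (.s1_of_no_gap j ?_ (by omega))⟩
        · omega
        · rw [e', e]; omega
  | s1 =>
    simp only [IsPos] at hm
    exact ⟨.s2, 0, .s2, rfl, Or.inr ⟨rfl, hm⟩, Or.inl .sink⟩
  | s2 =>
    simp only [IsPos] at hm
    subst hm
    have hlt := T.i_lt 0 (by omega)
    rw [zero_add] at hlt
    have hmo := T.i_mono (show 1 ≤ T.k by omega) le_rfl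
    rcases Nat.lt_or_ge 1 T.k with h | h
    · obtain ⟨q, hq⟩ := mk (T.i 1 - 1) (by omega) (by omega)
      exact ⟨.x q, 1, (T.isVertex_x_iff q).2
        ⟨0, by omega, by omega, by rw [zero_add]; omega, by omega⟩,
        ⟨0, by omega, by omega, by rw [zero_add]; omega, by rw [zero_add]; omega⟩, Or.inl rfl,
        Or.inr (.s2 q (by omega))⟩
    · have e : T.k = 1 := by omega
      rw [e] at hl
      obtain ⟨q, hq⟩ := mk n (by omega) (by omega)
      exact ⟨.x q, 1, (T.isVertex_x_iff q).2
        ⟨0, by omega, by omega, by rw [zero_add]; omega, by omega⟩,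
        ⟨0, by omega, by omega, by rw [zero_add]; omega, by rw [zero_add]; omega⟩, Or.inl rfl,
        Or.inr (.s2 q (by omega))⟩

lemma consec_unique {N a b c : ℕ} (hb : b < N) (hc : c < N) (h1 : Consec N a b)
    (h2 : Consec N a c) : b = c := by
  unfold Consec at h1 h2; omega

/-- Adjacency in the graph of a sequence is consecutiveness in the cyclic order. -/
lemma cycle_adj_iff (T : BreakSeq n) (hn : 2 ≤ n) (u w : T.Vertex) {a b : ℕ}
    (ha : T.IsPos u.1 a) (hb : T.IsPos w.1 b) :
    T.cycle.Adj u w ↔ Consec (n + T.k) a b ∨ Consec (n + T.k) b a := by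
  have hk := T.k_pos
  rw [cycle, SimpleGraph.fromRel_adj]
  constructor
  · rintro ⟨-, h | h⟩
    · exact T.isEdge_consec h ha hb
    · exact (T.isEdge_consec h hb ha).symm
  · intro h
    refine ⟨?_, ?_⟩
    · rintro rfl
      have := T.isPos_fun ha hb
      unfold Consec at h
      omega
    · rcases h with h | h
      · obtain ⟨w', b', hw', hb', hc, he⟩ := T.exists_next hn u.2 ha
        obtain rfl := consec_unique (T.isPos_lt hn hb) (T.isPos_lt hn hb') h hc
        rwa [T.isPos_inj w.2 hw' hb hb']
      · obtain ⟨u', b', hu', hb', hc, he⟩ := T.exists_next hn w.2 hb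
        obtain rfl := consec_unique (T.isPos_lt hn ha) (T.isPos_lt hn hb') h hc
        rw [T.isPos_inj u.2 hu' ha hb']
        exact he.symm

lemma exists_vertex_of_lt (T : BreakSeq n) (hn : 2 ≤ n) (m : ℕ) (hm : m < n + T.k) :
    ∃ w, T.IsVertex w ∧ T.IsPos w m := by
  induction m with
  | zero => exact ⟨.s2, .s2, rfl⟩
  | succ m ih =>
    obtain ⟨u, hu, hum⟩ := ih (by omega)
    obtain ⟨w, b, hw, hb, hc, -⟩ := T.exists_next hn hu hum
    have : b = m + 1 := by unfold Consec at hc; omega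
    exact ⟨w, hw, this ▸ hb⟩

lemma cycleGraph_adj_iff_consec {N : ℕ} (hN : 3 ≤ N) (a b : Fin N) :
    (SimpleGraph.cycleGraph N).Adj a b ↔ Consec N a b ∨ Consec N b a := by
  rw [SimpleGraph.cycleGraph_adj']
  unfold Consec
  have ha := a.2
  have hb := b.2
  rw [Fin.sub_def, Fin.sub_def]
  simp only
  have e1 : ∀ c d : ℕ, c < N → d < N → ((N - d + c) % N = 1 ↔ d + 1 = c ∨ (c = 0 ∧ d + 1 = N)) := by
    intro c d hc hd
    rcases Nat.lt_or_ge c d with h | h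
    · rw [Nat.mod_eq_of_lt (by omega)]; omega
    · have : N - d + c = c - d + N := by omega
      rw [this, Nat.add_mod_right, Nat.mod_eq_of_lt (by omega)]; omega
  rw [e1 _ _ ha hb, e1 _ _ hb ha]
  tauto

lemma cycle_isCycle (T : BreakSeq n) (hn : 2 ≤ n) :
    ∃ m : ℕ, 3 ≤ m ∧ Nonempty (T.cycle ≃g SimpleGraph.cycleGraph m) := by
  have hk := T.k_pos
  refine ⟨n + T.k, by omega, ?_⟩
  choose pos hpos using fun u : T.Vertex => T.exists_isPos hn u.2
  let f : T.Vertex → Fin (n + T.k) := fun u => ⟨pos u, T.isPos_lt hn (hpos u)⟩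
  have hf : Function.Bijective f := by
    constructor
    · intro u w h
      have h' : pos u = pos w := congrArg Fin.val h
      exact Subtype.ext (T.isPos_inj u.2 w.2 (hpos u) (h' ▸ hpos w))
    · intro m
      obtain ⟨w, hw, hm⟩ := T.exists_vertex_of_lt hn m.1 m.2
      exact ⟨⟨w, hw⟩, Fin.ext (T.isPos_fun (hpos ⟨w, hw⟩) hm)⟩
  refine ⟨⟨Equiv.ofBijective f hf, ?_⟩⟩
  intro u w
  rw [T.cycle_adj_iff hn u w (hpos u) (hpos w), cycleGraph_adj_iff_consec (by omega)]
  rfl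

lemma eq_or_adj_of_mainLabel_eq (T : BreakSeq n) (u w : T.Vertex)
    (h : T.mainLabel u.1 = T.mainLabel w.1) : u = w ∨ T.cycle.Adj u w := by
  by_cases huw : u = w
  · exact Or.inl huw
  · refine Or.inr ((SimpleGraph.fromRel_adj _ _ _).2 ⟨huw, ?_⟩)
    obtain ⟨u, hu⟩ := u
    obtain ⟨w, hw⟩ := w
    have hne : u ≠ w := fun h => huw (Subtype.ext h)
    have vv : ∀ j l : Fin (T.k - 1), T.i j.1 = T.i l.1 → j = l := by
      intro j l h
      have hj := j.2
      have hl := l.2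
      rcases Nat.lt_trichotomy j.1 l.1 with h' | h' | h'
      · have := T.i_mono (show j.1 + 1 ≤ l.1 by omega) (by omega)
        have := T.i_lt j.1 (by omega)
        omega
      · exact Fin.ext h'
      · have := T.i_mono (show l.1 + 1 ≤ j.1 by omega) (by omega)
        have := T.i_lt l.1 (by omega)
        omega
    cases u <;> cases w <;> simp only [mainLabel, SVar.x.injEq, reduceCtorEq] at h
    case x.x p q => exact absurd (by rw [h]) hne
    case x.v p j => exact Or.inl (.basic p j (by rw [h]; rfl))
    case v.x j p => exact Or.inr (.basic p j (by rw [← h]; rfl))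
    case v.v j l => exact absurd (by rw [vv j l (congrArg Subtype.val h)]) hne
    case s1.s1 => exact absurd rfl hne
    case s1.s2 => exact Or.inl .sink
    case s2.s1 => exact Or.inr .sink
    case s2.s2 => exact absurd rfl hne

lemma partition_connected (T : BreakSeq n) (P : Finset T.Vertex) (hP : P ∈ T.partition.parts) :
    (T.cycle.induce (P : Set T.Vertex)).Connected := by
  classical
  have hrel : ∀ u ∈ P, ∀ w ∈ P, T.mainLabel u.1 = T.mainLabel w.1 := by
    intro u hu w hw
    have h1 : T.partition.part u = P := T.partition.part_eq_of_mem hP hu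
    rw [← h1] at hw
    exact Finpartition.mem_part_ofSetoid_iff_rel.1 hw
  obtain ⟨u, hu⟩ := T.partition.nonempty_of_mem_parts hP
  have : Nonempty (P : Set T.Vertex) := ⟨⟨u, hu⟩⟩
  refine ⟨fun a b => ?_⟩
  rcases T.eq_or_adj_of_mainLabel_eq a.1 b.1 (hrel _ a.2 _ b.2) with h | h
  · rw [Subtype.ext h]
  · exact SimpleGraph.Adj.reachable (by simpa using h)

/-- The parcycle of a sequence. -/
noncomputable def parcycle (T : BreakSeq n) (hn : 2 ≤ n) : Parcycle T.Vertex where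
  graph := T.cycle
  isCycle := T.cycle_isCycle hn
  partition := T.partition
  connected := T.partition_connected

/-- The sink `{s_1, s_2}`. -/
def sinkVertex (T : BreakSeq n) : Finset T.Vertex := {⟨.s1, .s1⟩, ⟨.s2, .s2⟩}


/-! ## The ring `S`, the sequence `A` and the substitution -/

/-- The polynomial ring `S = K[x_1, …, x_{n+1}, x_{v_0}, …, x_{v_{k-2}}, x_{s_1}, x_{s_2}]`. -/
abbrev SRing (K : Type*) [Field K] (T : BreakSeq n) : Type _ := MvPolynomial (SVar n T.k) K

/-- The inclusion of `R_{n+1}` in `S`. -/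
noncomputable def incl (K : Type*) [Field K] (T : BreakSeq n) : RRing K n →ₐ[K] T.SRing K :=
  MvPolynomial.rename SVar.x

/-- The ideal of `S` generated by the toppling ideal of the parcycle. -/
noncomputable def topplingIdeal (K : Type*) [Field K] (T : BreakSeq n) (hn : 2 ≤ n) :
    Ideal (T.SRing K) :=
  ((T.parcycle hn).topplingIdeal K).map
    (MvPolynomial.rename (R := K) (Subtype.val : T.Vertex → SVar n T.k))

/-- The ideal of `S` generated by the `G`-parking function ideal of the parcycle with sink
`{s_1, s_2}`. -/
noncomputable def parkingIdeal (K : Type*) [Field K] (T : BreakSeq n) (hn : 2 ≤ n) :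
    Ideal (T.SRing K) :=
  ((T.parcycle hn).parkingIdeal K T.sinkVertex).map
    (MvPolynomial.rename (R := K) (Subtype.val : T.Vertex → SVar n T.k))

/-- The ideal generated by the sequence `A`, consisting of `x_{v_j} - x_{i_{j+2}}` for
`0 ≤ j ≤ k - 2`, `x_{s_1} - x_{i_{k-1}}` and `x_{s_2} - x_{i_1}`. -/
noncomputable def seqIdeal (K : Type*) [Field K] (T : BreakSeq n) : Ideal (T.SRing K) :=
  Ideal.span
    (Set.range (fun j : Fin (T.k - 1) =>
        (MvPolynomial.X (.v j) -
          MvPolynomial.X (.x (T.idx (j.1 + 2) (by have := j.2; omega))) : T.SRing K)) ∪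
     {MvPolynomial.X .s1 - MvPolynomial.X (.x (T.idx (T.k - 1) (Nat.sub_le _ _))),
      MvPolynomial.X .s2 - MvPolynomial.X (.x (T.idx 1 T.k_pos))})

/-- The substitution `ψ : S → R_{n+1}` given by `x_p ↦ x_p`, `x_{v_j} ↦ x_{i_{j+2}}`,
`x_{s_1} ↦ x_{i_{k-1}}` and `x_{s_2} ↦ x_{i_1}`. -/
noncomputable def subst (K : Type*) [Field K] (T : BreakSeq n) : T.SRing K →ₐ[K] RRing K n :=
  MvPolynomial.aeval fun w => match w with
    | .x p => MvPolynomial.X p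
    | .v j => MvPolynomial.X (T.idx (j.1 + 2) (by have := j.2; omega))
    | .s1 => MvPolynomial.X (T.idx (T.k - 1) (Nat.sub_le _ _))
    | .s2 => MvPolynomial.X (T.idx 1 T.k_pos)

end BreakSeq

/-! ## Gradings -/

/-- The degree `d` piece of a quotient of a (standard graded) polynomial ring. -/
noncomputable def quotientPiece {K σ : Type*} [Field K] (I : Ideal (MvPolynomial σ K)) (d : ℕ) :
    Submodule K (MvPolynomial σ K ⧸ I) :=
  (MvPolynomial.homogeneousSubmodule σ K d).map (Ideal.Quotient.mkₐ K I).toLinearMap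

/-- The degree `d` piece of the tensor product of two quotients of a polynomial ring, spanned by
the products `a ⊗ b` with `a`, `b` homogeneous of degrees that add up to `d`. -/
noncomputable def tensorPiece {K σ : Type*} [Field K] (I J : Ideal (MvPolynomial σ K)) (d : ℕ) :
    Submodule K ((MvPolynomial σ K ⧸ I) ⊗[MvPolynomial σ K] (MvPolynomial σ K ⧸ J)) :=
  Submodule.span K {z | ∃ p q : ℕ, p + q = d ∧
    ∃ a ∈ quotientPiece I p, ∃ b ∈ quotientPiece J q, z = a ⊗ₜ[MvPolynomial σ K] b}

/-- The substitution `ψ` induces an isomorphism of graded rings (and of `R_{n+1}`-modules)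
from `S/I ⊗_S S/⟨A⟩` onto `R_{n+1}/Q`. -/
def BreakSeq.InducesGradedIso {n : ℕ} (K : Type*) [Field K] (T : BreakSeq n)
    (I : Ideal (T.SRing K)) (Q : Ideal (RRing K n)) : Prop :=
  Nonempty (GradedAlgebra (R := K)
    (A := (T.SRing K ⧸ I) ⊗[T.SRing K] (T.SRing K ⧸ T.seqIdeal K))
    (tensorPiece I (T.seqIdeal K))) ∧
  Nonempty (GradedAlgebra (quotientPiece Q)) ∧
  ∃ e : ((T.SRing K ⧸ I) ⊗[T.SRing K] (T.SRing K ⧸ T.seqIdeal K)) ≃ₐ[K] (RRing K n ⧸ Q),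
    (∀ f g : T.SRing K,
      e (Ideal.Quotient.mk I f ⊗ₜ[T.SRing K] Ideal.Quotient.mk (T.seqIdeal K) g) =
        Ideal.Quotient.mk Q (T.subst K f * T.subst K g)) ∧
    (∀ (r : RRing K n) (z : (T.SRing K ⧸ I) ⊗[T.SRing K] (T.SRing K ⧸ T.seqIdeal K)),
      e (T.incl K r • z) = r • e z) ∧
    ∀ d : ℕ, (tensorPiece I (T.seqIdeal K) d).map e.toLinearMap = quotientPiece Q d

/-! The substitution ψ is surjective with kernel ⟨A⟩, because modulo ⟨A⟩ every variable of S equals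
its image under ψ. Hence S/I ⊗ S/⟨A⟩ is R/ψ(I)R for every ideal I of S. Since ψ preserves degrees,
the isomorphism is graded as soon as ψ(I)R is homogeneous (`inducesGradedIso_of_map_eq`). It remains
to compute two image ideals, and the cyclic order of the vertices does this.

Number the cycle by positions, with s_2 at 0 and s_1 at n + k - 1. Each block [i_r, i_{r+1}) of
labels is listed in decreasing order. The missing label i_{k-1} would sit exactly where s_1 sits,
and ψ sends x_{s_1} to x_{i_{k-1}}. The edges joining two distinct main vertices are therefore
indexed by c = 1, …, n: edge c enters the position of x_c. Under ψ its head becomes x_c and its tail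
becomes x_{c+1} (`target_eq_of_isPos`, `target_eq_succ_of_isPos`).

An arc that starts at the head of edge c and ends at the tail of edge d is a connected parset
avoiding the sink, and all such parsets have this form (`exists_eq_arc`). The Laplacian rows over
the arc add up to head c + tail d - tail c - head d, and its cut monomial is head c times tail d. So
ψ turns them into the minor x_c x_{d+1} - x_{c+1} x_d and its term x_c x_{d+1}. The arc exists
precisely when c comes before d in the cyclic order: either c lies in an earlier block, which gives
a main diagonal, or c > d in the same block, which gives an anti-diagonal. These are the generators
of P_n up to sign, and the generators of the monomial ideal.

For the inclusion of ψ(toppling ideal) in P_n, the lattice is orthogonal to every function that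
drops by a constant along all edges c. The constant function 1 and the index of the image under ψ
are such functions. So ψ sends a lattice binomial to a difference of monomials of equal degree and
equal weight, and such differences lie in P_n (`monomial_sub_monomial_mem`). -/

/-! ### Pushing gradings forward; tensor products of quotient rings. -/

/-- A surjective algebra homomorphism with homogeneous kernel pushes a grading forward. -/
theorem nonempty_gradedAlgebra_map {K A B : Type*} [Field K] [CommRing A] [Algebra K A]
    [Ring B] [Algebra K B] (𝒜 : ℕ → Submodule K A) [GradedAlgebra 𝒜] (f : A →ₐ[K] B)
    (hf : Function.Surjective f) (hker : (RingHom.ker f).IsHomogeneous 𝒜) :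
    Nonempty (GradedAlgebra fun d => (𝒜 d).map f.toLinearMap) := by
  classical
  let φ : ∀ i, 𝒜 i →ₗ[K] ((𝒜 i).map f.toLinearMap : Submodule K B) := fun i =>
    f.toLinearMap.restrict fun a ha => Submodule.mem_map_of_mem ha
  have hφ : ∀ i, Function.Surjective (φ i) := by
    rintro i ⟨_, a, ha, rfl⟩
    exact ⟨⟨a, ha⟩, rfl⟩
  have hcoe : ∀ y : DirectSum ℕ fun i => 𝒜 i,
      DirectSum.coeLinearMap (fun d => (𝒜 d).map f.toLinearMap) (DirectSum.lmap φ y) =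
        f (DirectSum.coeLinearMap 𝒜 y) := by
    intro y
    induction y using DirectSum.induction_on with
    | zero => simp
    | of i x =>
      erw [DirectSum.lmap_lof, DirectSum.coeLinearMap_lof, DirectSum.coeLinearMap_lof]
      rfl
    | add x y hx hy => simp only [map_add, hx, hy]
  have hint : DirectSum.IsInternal fun d => (𝒜 d).map f.toLinearMap := by
    constructor
    -- If the pieces of y sum into the kernel, homogeneity puts each piece in the kernel, so every
    -- component of the image of y vanishes.
    · refine (injective_iff_map_eq_zero _).2 fun x hx => ?_
      obtain ⟨y, rfl⟩ : ∃ y, DirectSum.lmap φ y = x :=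
        (DirectSum.lmap_surjective φ).2 hφ x
      have h0 : f (DirectSum.coeLinearMap 𝒜 y) = 0 := (hcoe y).symm.trans hx
      ext i
      have h1 := hker i (show DirectSum.coeLinearMap 𝒜 y ∈ RingHom.ker f from h0)
      have h2 : DirectSum.decompose 𝒜 (DirectSum.coeLinearMap 𝒜 y) = y :=
        DirectSum.Decomposition.right_inv y
      rw [h2] at h1
      exact h1
    · intro b
      obtain ⟨a, rfl⟩ := hf b
      refine ⟨DirectSum.lmap φ (DirectSum.decompose 𝒜 a), (hcoe _).trans ?_⟩
      exact congrArg f (DirectSum.Decomposition.left_inv a)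
  have : SetLike.GradedMonoid fun d => (𝒜 d).map f.toLinearMap :=
    { one_mem := ⟨1, SetLike.GradedOne.one_mem, map_one f⟩
      mul_mem := by
        rintro i j _ _ ⟨a, ha, rfl⟩ ⟨b, hb, rfl⟩
        exact ⟨a * b, SetLike.GradedMul.mul_mem ha hb, map_mul f a b⟩ }
  exact ⟨{ this, hint.chooseDecomposition with }⟩

/-- Every element of `S/I ⊗_S S/J` is of the form `f ⊗ 1`. -/
theorem exists_eq_mk_tmul_one {S : Type*} [CommRing S] (I J : Ideal S)
    (z : (S ⧸ I) ⊗[S] (S ⧸ J)) :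
    ∃ f, z = Ideal.Quotient.mk I f ⊗ₜ[S] Ideal.Quotient.mk J 1 := by
  induction z using TensorProduct.induction_on with
  | zero => exact ⟨0, by simp⟩
  | tmul a b =>
    obtain ⟨f, rfl⟩ := Ideal.Quotient.mk_surjective a
    obtain ⟨g, rfl⟩ := Ideal.Quotient.mk_surjective b
    refine ⟨g * f, ?_⟩
    have h1 : Ideal.Quotient.mk I (g * f) = g • Ideal.Quotient.mk I f := rfl
    have h2 : Ideal.Quotient.mk J g = g • Ideal.Quotient.mk J 1 :=
      congrArg _ (mul_one g).symm
    rw [h1, h2, TensorProduct.smul_tmul]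
  | add x y hx hy =>
    obtain ⟨f, rfl⟩ := hx
    obtain ⟨g, rfl⟩ := hy
    exact ⟨f + g, by rw [map_add, TensorProduct.add_tmul]⟩

/-- For a surjection `ψ : S → R`, the ring `S/I ⊗_S S/ker ψ` is `R/ψ(I)`. -/
theorem exists_algEquiv_quotient_tensor {K S R : Type*} [Field K] [CommRing S] [CommRing R]
    [Algebra K S] [Algebra K R] (ψ : S →ₐ[K] R) (hψ : Function.Surjective ψ) (I J : Ideal S)
    (Q : Ideal R) (hJ : RingHom.ker ψ = J) (hQ : I.map ψ = Q) :
    ∃ e : ((S ⧸ I) ⊗[S] (S ⧸ J)) ≃ₐ[K] (R ⧸ Q), ∀ f g : S,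
      e (Ideal.Quotient.mk I f ⊗ₜ[S] Ideal.Quotient.mk J g) =
        Ideal.Quotient.mk Q (ψ f * ψ g) := by
  -- Viewing R as an S-algebra through ψ makes both factors map to R/Q over S, so the universal
  -- property of the tensor product applies.
  let : Algebra S R := ψ.toRingHom.toAlgebra
  have halg : ∀ f, algebraMap S R f = ψ f := fun _ => rfl
  have : IsScalarTower K S R := IsScalarTower.of_algebraMap_eq fun c => by
    rw [halg, AlgHom.commutes]
  let f₁ : (S ⧸ I) →ₐ[S] (R ⧸ Q) :=
    Ideal.Quotient.liftₐ I (Algebra.ofId _ _) fun a ha => by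
      change Ideal.Quotient.mk Q (ψ a) = 0
      rw [Ideal.Quotient.eq_zero_iff_mem, ← hQ]
      exact Ideal.mem_map_of_mem _ ha
  let f₂ : (S ⧸ J) →ₐ[S] (R ⧸ Q) :=
    Ideal.Quotient.liftₐ _ (Algebra.ofId _ _) fun a ha => by
      change Ideal.Quotient.mk Q (ψ a) = 0
      rw [← hJ, RingHom.mem_ker] at ha
      rw [ha, map_zero]
  have hf₁ : ∀ f, f₁ (Ideal.Quotient.mk I f) = Ideal.Quotient.mk Q (ψ f) := fun _ => rfl
  have hf₂ : ∀ f, f₂ (Ideal.Quotient.mk J f) = Ideal.Quotient.mk Q (ψ f) := fun _ => rfl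
  obtain ⟨l, hl⟩ : ∃ l : ((S ⧸ I) ⊗[S] (S ⧸ J)) →ₐ[S] (R ⧸ Q), ∀ a b, l (a ⊗ₜ b) = f₁ a * f₂ b :=
    ⟨Algebra.TensorProduct.lift f₁ f₂ fun _ _ => Commute.all _ _,
      Algebra.TensorProduct.lift_tmul _ _ _⟩
  obtain ⟨e₀, he₀⟩ : ∃ e₀ : ((S ⧸ I) ⊗[S] (S ⧸ J)) →ₐ[K] (R ⧸ Q),
      ∀ f g : S, e₀ (Ideal.Quotient.mk I f ⊗ₜ[S] Ideal.Quotient.mk J g) =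
        Ideal.Quotient.mk Q (ψ f * ψ g) := by
    refine ⟨l.restrictScalars K, fun f g => ?_⟩
    rw [AlgHom.restrictScalars_apply, hl, hf₁, hf₂, map_mul]
  refine ⟨AlgEquiv.ofBijective e₀ ⟨(injective_iff_map_eq_zero _).2 fun z hz => ?_, fun q => ?_⟩,
    he₀⟩
  -- If ψ(f) lies in ψ(I), then f = g + (f - g) with g in I and f - g in J. The first summand dies
  -- in the left factor; the second moves across the tensor sign and dies in the right one.
  · obtain ⟨f, rfl⟩ := exists_eq_mk_tmul_one I J z
    have h1 := he₀ f 1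
    rw [map_one ψ, mul_one, hz, eq_comm, Ideal.Quotient.eq_zero_iff_mem, ← hQ,
      Ideal.mem_map_iff_of_surjective _ hψ] at h1
    obtain ⟨g, hg, hgf⟩ := h1
    have h2 : f - g ∈ J := by
      rw [← hJ, RingHom.mem_ker, map_sub, hgf, sub_self]
    have h3 : Ideal.Quotient.mk I f = (f - g) • Ideal.Quotient.mk I 1 :=
      Ideal.Quotient.eq.2 (by simpa using hg)
    have h4 : (f - g) • Ideal.Quotient.mk J 1 = 0 :=
      Ideal.Quotient.eq_zero_iff_mem.2 (by simpa using h2)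
    rw [h3, TensorProduct.smul_tmul, h4, TensorProduct.tmul_zero]
  · obtain ⟨r, rfl⟩ := Ideal.Quotient.mk_surjective q
    obtain ⟨f, rfl⟩ := hψ r
    refine ⟨Ideal.Quotient.mk I f ⊗ₜ Ideal.Quotient.mk _ 1, ?_⟩
    rw [he₀, map_one ψ, mul_one]

/-! ### The substitution ψ: its kernel, its degree, and the induced graded isomorphism. -/

namespace BreakSeq

variable {n : ℕ}

theorem subst_incl (K : Type*) [Field K] (T : BreakSeq n) (r : RRing K n) :
    T.subst K (T.incl K r) = r := by
  have : (T.subst K).comp (T.incl K) = AlgHom.id K _ := by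
    ext p
    simp [subst, incl]
  exact DFunLike.congr_fun this r

theorem subst_surjective (K : Type*) [Field K] (T : BreakSeq n) :
    Function.Surjective (T.subst K) := fun r => ⟨T.incl K r, T.subst_incl K r⟩

/-- Each generator of ⟨A⟩ is a variable minus its image, so the composite of ψ with the inclusion of
R is the identity modulo ⟨A⟩. An element killed by ψ is therefore itself in ⟨A⟩. -/
theorem ker_subst (K : Type*) [Field K] (T : BreakSeq n) :
    RingHom.ker (T.subst K) = T.seqIdeal K := by
  apply le_antisymm
  · intro f hf
    have key : ∀ f, f - T.incl K (T.subst K f) ∈ T.seqIdeal K := by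
      intro f
      have h : ((Ideal.Quotient.mkₐ K (T.seqIdeal K)).comp ((T.incl K).comp (T.subst K))) =
          Ideal.Quotient.mkₐ K (T.seqIdeal K) := by
        ext w
        refine (Ideal.Quotient.eq.2 ?_).symm
        cases w with
        | x p => simp [subst, incl]
        | v j =>
          refine Ideal.subset_span (Or.inl ⟨j, ?_⟩)
          simp [subst, incl]
        | s1 =>
          refine Ideal.subset_span (Or.inr (Or.inl ?_))
          simp [subst, incl]
        | s2 =>
          refine Ideal.subset_span (Or.inr (Or.inr ?_))
          simp [subst, incl]
      exact Ideal.Quotient.eq.1 (DFunLike.congr_fun h f).symm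
    have := key f
    rwa [RingHom.mem_ker.1 hf, map_zero, sub_zero] at this
  · refine Ideal.span_le.2 ?_
    rintro f (⟨j, rfl⟩ | rfl | rfl) <;> simp [subst, RingHom.mem_ker]

theorem isHomogeneous_subst {K : Type*} [Field K] (T : BreakSeq n) {f : T.SRing K} {d : ℕ}
    (hf : f.IsHomogeneous d) : (T.subst K f).IsHomogeneous d := by
  have := hf.aeval (fun w => T.subst K (MvPolynomial.X w)) (n := 1) (fun w => by
    cases w <;> simp [subst, MvPolynomial.isHomogeneous_X])
  rw [one_mul] at this
  convert this using 1
  exact DFunLike.congr_fun (MvPolynomial.aeval_unique (T.subst K)) f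

theorem isHomogeneous_incl {K : Type*} [Field K] (T : BreakSeq n) {f : RRing K n} {d : ℕ}
    (hf : f.IsHomogeneous d) : (T.incl K f).IsHomogeneous d :=
  hf.rename_isHomogeneous

attribute [local instance] MvPolynomial.gradedAlgebra

/-- The substitution induces a graded isomorphism as soon as it carries `I` onto a homogeneous
ideal `Q`. -/
theorem inducesGradedIso_of_map_eq {K : Type*} [Field K] (T : BreakSeq n)
    {I : Ideal (T.SRing K)} {Q : Ideal (RRing K n)} (hIQ : I.map (T.subst K) = Q)
    (hQ : Q.IsHomogeneous (MvPolynomial.homogeneousSubmodule (RIdx n) K)) :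
    T.InducesGradedIso K I Q := by
  obtain ⟨e, he⟩ := exists_algEquiv_quotient_tensor (T.subst K) (T.subst_surjective K) I
    (T.seqIdeal K) Q (T.ker_subst K) hIQ
  have hpiece : ∀ d, (tensorPiece I (T.seqIdeal K) d).map e.toLinearMap = quotientPiece Q d := by
    intro d
    apply le_antisymm
    · rw [tensorPiece, Submodule.map_span, Submodule.span_le]
      rintro _ ⟨_, ⟨p, q, hpq, _, ⟨f, hf, rfl⟩, _, ⟨g, hg, rfl⟩, rfl⟩, rfl⟩
      refine ⟨T.subst K f * T.subst K g, ?_, (he f g).symm⟩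
      rw [← hpq]
      exact (T.isHomogeneous_subst hf).mul (T.isHomogeneous_subst hg)
    · rintro _ ⟨r, hr, rfl⟩
      refine ⟨Ideal.Quotient.mk I (T.incl K r) ⊗ₜ Ideal.Quotient.mk _ 1, ?_, ?_⟩
      · refine Submodule.subset_span ⟨d, 0, add_zero d, _, ⟨T.incl K r, ?_, rfl⟩, _,
          ⟨1, ?_, rfl⟩, rfl⟩
        · exact T.isHomogeneous_incl hr
        · exact MvPolynomial.isHomogeneous_one _ _
      · refine (he _ _).trans ?_
        rw [T.subst_incl K, map_one, mul_one]
        rfl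
  -- The grading of the tensor product is pushed forward from R along R → R/Q ≃ S/I ⊗ S/⟨A⟩, whose
  -- kernel is the homogeneous ideal Q.
  have hker : RingHom.ker (e.symm.toAlgHom.comp (Ideal.Quotient.mkₐ K Q)) = Q := by
    ext x
    simp [RingHom.mem_ker, Ideal.Quotient.eq_zero_iff_mem]
  refine ⟨?_, ?_, e, he, ?_, hpiece⟩
  · obtain ⟨h⟩ := nonempty_gradedAlgebra_map (MvPolynomial.homogeneousSubmodule (RIdx n) K)
      (B := (T.SRing K ⧸ I) ⊗[T.SRing K] (T.SRing K ⧸ T.seqIdeal K))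
      (e.symm.toAlgHom.comp (Ideal.Quotient.mkₐ K Q))
      (e.symm.surjective.comp Ideal.Quotient.mk_surjective) (hker.symm ▸ hQ)
    have hfun : (fun d => (MvPolynomial.homogeneousSubmodule (RIdx n) K d).map
        (e.symm.toAlgHom.comp (Ideal.Quotient.mkₐ K Q)).toLinearMap) =
        tensorPiece I (T.seqIdeal K) := by
      funext d
      have h1 := hpiece d
      apply_fun Submodule.map e.symm.toLinearMap at h1
      rw [← Submodule.map_comp, quotientPiece, ← Submodule.map_comp] at h1
      have h2 : e.symm.toLinearMap ∘ₗ e.toLinearMap = LinearMap.id :=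
        LinearMap.ext fun z => e.symm_apply_apply z
      rw [h2, Submodule.map_id] at h1
      exact h1.symm
    rw [hfun] at h
    exact ⟨h⟩
  · exact nonempty_gradedAlgebra_map (MvPolynomial.homogeneousSubmodule (RIdx n) K)
      (Ideal.Quotient.mkₐ K Q) Ideal.Quotient.mk_surjective
      ((Ideal.Quotient.mkₐ_ker K Q).symm ▸ hQ)
  · intro r z
    obtain ⟨f, rfl⟩ := exists_eq_mk_tmul_one _ _ z
    rw [TensorProduct.smul_tmul']
    refine (he (T.incl K r * f) 1).trans ?_
    rw [he, map_mul (T.subst K), T.subst_incl K, mul_assoc]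
    rfl

end BreakSeq

/-! ### Images of the variables and the successor permutation of the cycle. -/

namespace BreakSeq

variable {n : ℕ}

/-- The index `p` with `ψ(x_w) = x_p`. -/
def target (T : BreakSeq n) : SVar n T.k → RIdx n
  | .x p => p
  | .v j => T.idx (j.1 + 2) (by have := j.2; omega)
  | .s1 => T.idx (T.k - 1) (Nat.sub_le _ _)
  | .s2 => T.idx 1 T.k_pos

theorem subst_X (K : Type*) [Field K] (T : BreakSeq n) (w : SVar n T.k) :
    T.subst K (MvPolynomial.X w) = MvPolynomial.X (T.target w) := by
  rw [subst, MvPolynomial.aeval_X]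
  cases w <;> rfl

/-- The position of a vertex in the cyclic order. -/
noncomputable def pos (T : BreakSeq n) (hn : 2 ≤ n) (u : T.Vertex) : ℕ :=
  (T.exists_isPos hn u.2).choose

theorem isPos_pos (T : BreakSeq n) (hn : 2 ≤ n) (u : T.Vertex) : T.IsPos u.1 (T.pos hn u) :=
  (T.exists_isPos hn u.2).choose_spec

theorem pos_lt (T : BreakSeq n) (hn : 2 ≤ n) (u : T.Vertex) : T.pos hn u < n + T.k :=
  T.isPos_lt hn (T.isPos_pos hn u)

theorem pos_eq_of_isPos (T : BreakSeq n) (hn : 2 ≤ n) {u : T.Vertex} {m : ℕ}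
    (h : T.IsPos u.1 m) : T.pos hn u = m := T.isPos_fun (T.isPos_pos hn u) h

theorem pos_injective (T : BreakSeq n) (hn : 2 ≤ n) : Function.Injective (T.pos hn) :=
  fun u w h => Subtype.ext (T.isPos_inj u.2 w.2 (T.isPos_pos hn u) (h ▸ T.isPos_pos hn w))

theorem exists_pos_eq (T : BreakSeq n) (hn : 2 ≤ n) {m : ℕ} (hm : m < n + T.k) :
    ∃ u, T.pos hn u = m := by
  obtain ⟨w, hw, h⟩ := T.exists_vertex_of_lt hn m hm
  exact ⟨⟨w, hw⟩, T.pos_eq_of_isPos hn h⟩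

theorem exists_consec (T : BreakSeq n) (hn : 2 ≤ n) (u : T.Vertex) :
    ∃ w, Consec (n + T.k) (T.pos hn u) (T.pos hn w) := by
  obtain ⟨w, b, hw, hb, hc, -⟩ := T.exists_next hn u.2 (T.isPos_pos hn u)
  refine ⟨⟨w, hw⟩, ?_⟩
  rwa [T.pos_eq_of_isPos hn (u := ⟨w, hw⟩) hb]

/-- The next vertex in the cyclic order. -/
noncomputable def nxt (T : BreakSeq n) (hn : 2 ≤ n) : Equiv.Perm T.Vertex :=
  -- Vertices with a common successor share their position; injectivity suffices on a finite set.
  Equiv.ofBijective (fun u => (T.exists_consec hn u).choose) <| Finite.injective_iff_bijective.1 <| by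
    intro u w h
    have h1 := (T.exists_consec hn u).choose_spec
    have h2 := (T.exists_consec hn w).choose_spec
    simp only at h
    rw [← h] at h2
    apply T.pos_injective hn
    unfold Consec at h1 h2
    omega

theorem consec_nxt (T : BreakSeq n) (hn : 2 ≤ n) (u : T.Vertex) :
    Consec (n + T.k) (T.pos hn u) (T.pos hn (T.nxt hn u)) :=
  (T.exists_consec hn u).choose_spec

theorem nxt_eq_iff (T : BreakSeq n) (hn : 2 ≤ n) (u w : T.Vertex) :
    T.nxt hn u = w ↔ Consec (n + T.k) (T.pos hn u) (T.pos hn w) := by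
  constructor
  · rintro rfl
    exact T.consec_nxt hn u
  · intro h
    exact T.pos_injective hn
      (consec_unique (T.pos_lt hn _) (T.pos_lt hn _) (T.consec_nxt hn u) h)

theorem cycle_adj_iff_nxt (T : BreakSeq n) (hn : 2 ≤ n) (u w : T.Vertex) :
    T.cycle.Adj u w ↔ T.nxt hn u = w ∨ (T.nxt hn).symm u = w := by
  rw [T.cycle_adj_iff hn u w (T.isPos_pos hn u) (T.isPos_pos hn w), Equiv.symm_apply_eq,
    eq_comm (a := u), T.nxt_eq_iff, T.nxt_eq_iff]

/-- The cycle has n + k ≥ 3 vertices, so the two neighbours of a vertex are distinct. -/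
theorem nxt_ne_symm (T : BreakSeq n) (hn : 2 ≤ n) (u : T.Vertex) :
    T.nxt hn u ≠ (T.nxt hn).symm u := by
  have hk := T.k_pos
  intro h
  rw [Equiv.eq_symm_apply, T.nxt_eq_iff] at h
  have h2 := T.consec_nxt hn u
  unfold Consec at h h2
  omega

theorem nxt_ne_self (T : BreakSeq n) (hn : 2 ≤ n) (u : T.Vertex) : T.nxt hn u ≠ u := by
  intro h
  rw [T.nxt_eq_iff] at h
  unfold Consec at h
  omega

theorem filter_adj (T : BreakSeq n) (hn : 2 ≤ n) (u : T.Vertex) [DecidablePred (T.cycle.Adj u)] :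
    Finset.univ.filter (T.cycle.Adj u) = {T.nxt hn u, (T.nxt hn).symm u} := by
  ext w
  simp [T.cycle_adj_iff_nxt hn, eq_comm]

/-! ## Relevant edges -/

/-- The vertex at the position of `x_c` has target `c`, whether or not `x_c` is a vertex. -/
theorem target_eq_of_isPos (T : BreakSeq n) {w : SVar n T.k} (hw : T.IsVertex w) {c : RIdx n}
    {f : ℕ} (hwf : T.IsPos w f) (hc : T.IsPos (.x c) f) : T.target w = c := by
  have hk := T.k_pos
  by_cases hv : T.IsVertex (.x c)
  · rw [T.isPos_inj hw hv hwf hc]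
    rfl
  · obtain ⟨r, hr, h1, h2, h3⟩ := hc
    -- The only label below n + 1 that is not a vertex is i_{k-1}; its position is that of s_1,
    -- whose target is i_{k-1}.
    have h4 : r + 1 = T.k ∧ c.1 = T.i r := by
      by_contra h
      exact hv ((T.isVertex_x_iff c).2 ⟨r, hr, h1, h2, by omega⟩)
    have hl := T.i_last
    rw [← h4.1] at hl
    have hs : T.IsPos .s1 f := by simp only [IsPos]; omega
    rw [T.isPos_inj hw .s1 hwf hs]
    refine Subtype.ext ?_
    simp only [target, idx]
    rw [h4.2]
    exact congrArg T.i (by omega)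

/-- Inside a block the labels descend by one. The vertices s_2 and v_j stand just before the labels
i_1 - 1 and i_{j+2} - 1, and ψ gives them the values x_{i_1} and x_{i_{j+2}} that continue the
descent backwards. -/
theorem target_eq_succ_of_isPos (T : BreakSeq n) (hn : 2 ≤ n) {u : SVar n T.k}
    (hu : T.IsVertex u) {c : RIdx n} {m : ℕ} (hum : T.IsPos u m) (hc : T.IsPos (.x c) (m + 1)) :
    (T.target u).1 = c.1 + 1 := by
  have hk := T.k_pos
  have hl := T.i_last
  have hlt := T.isPos_lt hn hc
  -- Distinct blocks occupy disjoint ranges of positions, so the label at position m + 1 is unique.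
  have huniq : ∀ d : ℕ, ∀ s < T.k, T.i s ≤ d → d < T.i (s + 1) →
      m + 1 + d + 1 = T.i s + T.i (s + 1) + s → c.1 = d := by
    intro d s hs h4 h5 h6
    obtain ⟨r, hr, h1, h2, h3⟩ := hc
    rcases Nat.lt_trichotomy r s with h | rfl | h
    · have := T.i_mono (show r + 1 ≤ s by omega) (by omega); omega
    · omega
    · have := T.i_mono (show s + 1 ≤ r by omega) (by omega); omega
  cases u with
  | x p =>
    obtain ⟨s, hs, h4, h5, h6⟩ := hum
    change p.1 = c.1 + 1
    by_cases hps : p.1 = T.i s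
    · exfalso
      obtain ⟨r, hr, h1, h2, h3⟩ := hc
      rcases Nat.lt_trichotomy r s with h | rfl | h
      · have := T.i_mono (show r + 1 ≤ s by omega) (by omega); omega
      · omega
      · have := T.i_mono (show s + 1 ≤ r by omega) (by omega); omega
    · have := huniq (p.1 - 1) s hs (by omega) (by omega) (by omega)
      omega
  | v j =>
    have hj := j.2
    simp only [IsPos] at hum
    have := T.i_lt (j.1 + 1) (by omega)
    have := huniq (T.i (j.1 + 1 + 1) - 1) (j.1 + 1) (by omega) (by omega) (by omega) (by omega)
    change T.i (j.1 + 1 + 1) = c.1 + 1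
    omega
  | s1 => simp only [IsPos] at hum; omega
  | s2 =>
    simp only [IsPos] at hum
    have h0 := T.i_zero
    have := T.i_lt 0 (by omega)
    rw [zero_add] at this
    have := huniq (T.i 1 - 1) 0 (by omega) (by omega) (by rw [zero_add]; omega)
      (by rw [zero_add]; omega)
    change T.i 1 = c.1 + 1
    omega

theorem pos_x_pos (T : BreakSeq n) {c : RIdx n} {f : ℕ} (hc : T.IsPos (.x c) f) : 1 ≤ f := by
  obtain ⟨r, hr, h1, h2, h3⟩ := hc
  have := T.i_mono (Nat.zero_le r) hr.le
  rw [T.i_zero] at this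
  omega

theorem not_isPos_v_of_x (T : BreakSeq n) {c : RIdx n} {f : ℕ} (hc : T.IsPos (.x c) f)
    (j : Fin (T.k - 1)) : ¬ T.IsPos (.v j) f := by
  obtain ⟨r, hr, h1, h2, h3⟩ := hc
  intro hj
  simp only [IsPos] at hj
  have hj2 := j.2
  rcases Nat.lt_or_ge j.1 r with h | h
  · have := T.i_mono (show j.1 + 1 ≤ r by omega) (by omega); omega
  · have := T.i_mono (show r + 1 ≤ j.1 + 1 by omega) (by omega); omega

/-- The edge that enters the position of `x_c` joins two main vertices. -/
theorem mainLabel_ne_of_isPos (T : BreakSeq n) (hn : 2 ≤ n) {u w : T.Vertex} {c : RIdx n}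
    (hc : T.IsPos (.x c) (T.pos hn w)) (huw : T.pos hn u + 1 = T.pos hn w) :
    T.mainLabel u.1 ≠ T.mainLabel w.1 := by
  have hk := T.k_pos
  have hu' := T.isPos_pos hn u
  have hw' := T.isPos_pos hn w
  generalize T.pos hn u = a at *
  generalize T.pos hn w = b at *
  obtain ⟨u, hu⟩ := u
  obtain ⟨w, hw⟩ := w
  intro h
  cases w with
  | v j => exact T.not_isPos_v_of_x hc j hw'
  | s2 => simp only [IsPos] at hw'; omega
  | s1 =>
    cases u with
    | s1 => simp only [IsPos] at hu' hw'; omega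
    | s2 => simp only [IsPos] at hu' hw'; omega
    | _ => simp [mainLabel] at h
  | x p =>
    cases u with
    | s1 => simp [mainLabel] at h
    | s2 => simp [mainLabel] at h
    | x q =>
      simp only [mainLabel, SVar.x.injEq] at h
      subst h
      have := T.isPos_fun hu' hw'
      omega
    | v j =>
      simp only [mainLabel, SVar.x.injEq] at h
      have hj := j.2
      have h1 := T.i_lt j.1 (by omega)
      have h2 : T.IsPos (.x p) (T.i (j.1 + 1) + j.1 - 1) := by
        rw [← h]
        exact ⟨j.1, by omega, le_rfl, h1, by simp only [idx]; omega⟩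
      have h3 := T.isPos_fun h2 hw'
      simp only [IsPos] at hu'
      omega

/-- An edge that joins two main vertices enters the position of some `x_c`. -/
theorem exists_isPos_of_mainLabel_ne (T : BreakSeq n) (hn : 2 ≤ n) {u w : T.Vertex}
    (huw : Consec (n + T.k) (T.pos hn u) (T.pos hn w))
    (h : T.mainLabel u.1 ≠ T.mainLabel w.1) :
    T.pos hn u + 1 = T.pos hn w ∧ ∃ c : RIdx n, T.IsPos (.x c) (T.pos hn w) := by
  have hk := T.k_pos
  have hl := T.i_last
  have hu' := T.isPos_pos hn u
  have hw' := T.isPos_pos hn w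
  -- The edge that wraps around is s_1 s_2, which lies inside the sink.
  have hpos : T.pos hn u + 1 = T.pos hn w := by
    by_contra hne
    have h1 : T.pos hn w = 0 ∧ T.pos hn u + 1 = n + T.k := by unfold Consec at huw; omega
    apply h
    rw [T.isPos_inj u.2 .s1 hu' h1.2, T.isPos_inj w.2 .s2 hw' h1.1]
    rfl
  refine ⟨hpos, ?_⟩
  generalize T.pos hn u = a at *
  generalize T.pos hn w = b at *
  obtain ⟨u, hu⟩ := u
  obtain ⟨w, hw⟩ := w
  cases w with
  | x p => exact ⟨p, hw'⟩
  | v j =>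
    -- The predecessor of v_j is i_j, in the same main vertex.
    exfalso
    have hj := j.2
    simp only [IsPos] at hw'
    have h1 := T.i_lt j.1 (by omega)
    have h2 : T.IsPos (.x (T.idx j.1 (by omega))) a :=
      ⟨j.1, by omega, le_rfl, h1, by simp only [idx]; omega⟩
    apply h
    have h3 := T.isPos_inj hu (.typeII _ j.1 (by omega) rfl) hu' h2
    exact (congrArg T.mainLabel h3).trans rfl
  | s1 =>
    refine ⟨T.idx (T.k - 1) (Nat.sub_le _ _), T.k - 1, by omega, le_rfl, T.i_lt _ (by omega), ?_⟩
    simp only [IsPos] at hw'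
    have e : T.i (T.k - 1 + 1) = T.i T.k := congrArg T.i (by omega)
    rw [e]
    simp only [idx]
    omega
  | s2 => simp only [IsPos] at hw'; omega

/-- Along an edge that joins two main vertices the target drops by one. -/
theorem target_eq_of_mainLabel_ne (T : BreakSeq n) (hn : 2 ≤ n) (u : T.Vertex)
    (h : T.mainLabel u.1 ≠ T.mainLabel (T.nxt hn u).1) :
    (T.target u.1).1 = (T.target (T.nxt hn u).1).1 + 1 := by
  obtain ⟨h1, c, hc⟩ := T.exists_isPos_of_mainLabel_ne hn (T.consec_nxt hn u) h
  rw [T.target_eq_of_isPos (T.nxt hn u).2 (T.isPos_pos hn _) hc]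
  exact T.target_eq_succ_of_isPos hn u.2 (T.isPos_pos hn u) (h1 ▸ hc)

end BreakSeq

namespace BreakSeq

variable {n : ℕ}

/-! ## Sums of rows of the Laplacian matrix -/

/-- Every vertex has degree 2. The row is grouped as the vector of the outgoing edge minus the
vector of the incoming edge, ready for summation by parts. -/
theorem lapRow_apply (T : BreakSeq n) (hn : 2 ≤ n) (u w : T.Vertex) :
    (T.parcycle hn).lapRow u w =
      (Pi.single u 1 - Pi.single (T.nxt hn u) 1 : T.Vertex → ℤ) w -
      (Pi.single ((T.nxt hn).symm u) 1 - Pi.single u 1 : T.Vertex → ℤ) w := by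
  classical
  have h1 : ∀ inst : DecidablePred (T.cycle.Adj u),
      (@Finset.filter _ (T.cycle.Adj u) inst Finset.univ).card = 2 := by
    intro inst
    rw [T.filter_adj hn, Finset.card_pair (T.nxt_ne_symm hn u)]
  have h2 := T.nxt_ne_self hn u
  have h3 : (T.nxt hn).symm u ≠ u := fun h => h2 ((Equiv.symm_apply_eq _).1 h).symm
  have h4 := T.nxt_ne_symm hn u
  have h5 : ∀ [DecidableRel T.cycle.Adj], T.cycle.degree u = 2 := by
    intro _
    rw [← SimpleGraph.card_neighborFinset_eq_degree, SimpleGraph.neighborFinset_eq_filter]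
    exact h1 _
  change T.cycle.lapMatrix ℤ u w = _
  rw [SimpleGraph.lapMatrix, Matrix.sub_apply, SimpleGraph.degMatrix, Matrix.diagonal_apply,
    SimpleGraph.adjMatrix_apply, h5]
  simp only [T.cycle_adj_iff_nxt hn, Pi.sub_apply, Pi.single_apply]
  by_cases hu : u = w
  · subst hu
    simp [h2, h3, h2.symm, h3.symm]
  · by_cases hw : T.nxt hn u = w
    · subst hw
      simp [h2, h4, hu]
    · by_cases hw' : (T.nxt hn).symm u = w
      · subst hw'
        simp [h3, h4, hu, h4.symm]
      · simp [hu, hw, hw', Ne.symm hu, Ne.symm hw, Ne.symm hw']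

/-- The sum of the rows over `S` only involves the edges between `S` and its complement. -/
theorem sum_lapRow (T : BreakSeq n) (hn : 2 ≤ n) (S : Finset T.Vertex) :
    ∑ j ∈ S, (T.parcycle hn).lapRow j =
      ∑ j, ((if j ∈ S then 1 else 0) - (if T.nxt hn j ∈ S then 1 else 0) : ℤ) •
        (Pi.single j 1 - Pi.single (T.nxt hn j) 1 : T.Vertex → ℤ) := by
  have h1 : ∀ j, (T.parcycle hn).lapRow j =
      (Pi.single j 1 - Pi.single (T.nxt hn j) 1 : T.Vertex → ℤ) -
      (Pi.single ((T.nxt hn).symm j) 1 - Pi.single j 1 : T.Vertex → ℤ) :=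
    fun j => funext fun w => T.lapRow_apply hn j w
  -- Reindexing by the successor rewrites the edge entering a vertex as the edge leaving its
  -- predecessor.
  have h2 : ∑ j ∈ S, (Pi.single ((T.nxt hn).symm j) 1 - Pi.single j 1 : T.Vertex → ℤ) =
      ∑ j, (if T.nxt hn j ∈ S then
        (Pi.single j 1 - Pi.single (T.nxt hn j) 1 : T.Vertex → ℤ) else 0) := by
    have h := Equiv.sum_comp (T.nxt hn) (fun j => if j ∈ S then
        (Pi.single ((T.nxt hn).symm j) 1 - Pi.single j 1 : T.Vertex → ℤ) else 0)
    simp only [Equiv.symm_apply_apply, Finset.sum_ite_mem, Finset.univ_inter] at h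
    exact h.symm
  simp only [h1, Finset.sum_sub_distrib, sub_smul, ite_smul, one_smul, zero_smul] at h2 ⊢
  rw [h2]
  simp [Finset.sum_ite_mem]

/-- A function that drops by a constant along the edges joining main vertices is orthogonal to
the lattice. -/
theorem sum_mul_eq_zero_of_mem_laplacianLattice (T : BreakSeq n) (hn : 2 ≤ n) (h : T.Vertex → ℤ)
    (c : ℤ) (hc : ∀ u : T.Vertex, T.mainLabel u.1 ≠ T.mainLabel (T.nxt hn u).1 →
      h u - h (T.nxt hn u) = c) {b : T.Vertex → ℤ} (hb : b ∈ (T.parcycle hn).laplacianLattice) :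
    ∑ w, b w * h w = 0 := by
  classical
  induction hb using AddSubgroup.closure_induction with
  | zero => simp
  | add x y _ _ hx hy => simp only [Pi.add_apply, add_mul, Finset.sum_add_distrib, hx, hy, add_zero]
  | neg x _ hx => simp only [Pi.neg_apply, neg_mul, Finset.sum_neg_distrib, hx, neg_zero]
  | mem x hx =>
    obtain ⟨P, hP, rfl⟩ := hx
    rw [T.sum_lapRow hn]
    simp only [Finset.sum_apply, Finset.sum_mul, Pi.smul_apply, smul_eq_mul]
    rw [Finset.sum_comm]
    have hin : ∀ u ∈ P, ∀ w, w ∈ P ↔ T.mainLabel u.1 = T.mainLabel w.1 := by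
      intro u hu w
      rw [← T.partition.part_eq_of_mem hP hu]
      exact Finpartition.mem_part_ofSetoid_iff_rel
    -- Edge j contributes only if its ends lie in different parts, and then h drops by exactly c
    -- along it.
    have key : ∀ j, (∑ w, ((if j ∈ P then 1 else 0) - (if T.nxt hn j ∈ P then 1 else 0) : ℤ) *
        (Pi.single j 1 - Pi.single (T.nxt hn j) 1 : T.Vertex → ℤ) w * h w) =
        ((if j ∈ P then 1 else 0) - (if T.nxt hn j ∈ P then 1 else 0)) * c := by
      intro j
      simp only [mul_assoc]
      rw [← Finset.mul_sum]
      simp only [Pi.sub_apply, sub_mul, Finset.sum_sub_distrib, Pi.single_apply, ite_mul, one_mul,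
        zero_mul, Finset.sum_ite_eq', Finset.mem_univ, if_true]
      by_cases h1 : T.mainLabel j.1 = T.mainLabel (T.nxt hn j).1
      · have : j ∈ P ↔ T.nxt hn j ∈ P :=
          ⟨fun hj => (hin j hj _).2 h1, fun hj => (hin _ hj _).2 h1.symm⟩
        simp [this]
      · have := hc j h1
        subst this
        split_ifs <;> ring
    -- The coefficients 1_P(j) - 1_P(next j) sum to zero around the cycle.
    rw [Finset.sum_congr rfl fun j _ => key j, ← Finset.sum_mul, Finset.sum_sub_distrib,
      Equiv.sum_comp (T.nxt hn) (fun j => if j ∈ P then (1 : ℤ) else 0), sub_self, zero_mul]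

/-! ## Parsets -/

theorem isParset_iff (T : BreakSeq n) (hn : 2 ≤ n) (S : Finset T.Vertex) :
    (T.parcycle hn).IsParset S ↔
      ∀ u ∈ S, ∀ w : T.Vertex, T.mainLabel u.1 = T.mainLabel w.1 → w ∈ S := by
  classical
  have hin : ∀ P ∈ T.partition.parts, ∀ u ∈ P, ∀ w, w ∈ P ↔ T.mainLabel u.1 = T.mainLabel w.1 := by
    intro P hP u hu w
    rw [← T.partition.part_eq_of_mem hP hu]
    exact Finpartition.mem_part_ofSetoid_iff_rel
  constructor
  · rintro ⟨U, hU, rfl⟩ u hu w huw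
    obtain ⟨P, hP, huP⟩ := Finset.mem_biUnion.1 hu
    exact Finset.mem_biUnion.2 ⟨P, hP, (hin P (hU hP) u huP w).2 huw⟩
  · intro h
    refine ⟨T.partition.parts.filter (· ⊆ S), Finset.filter_subset _ _, ?_⟩
    ext u
    rw [Finset.mem_biUnion]
    constructor
    · intro hu
      have hpu := T.partition.mem_part (Finset.mem_univ u)
      have hpm := T.partition.part_mem.2 (Finset.mem_univ u)
      exact ⟨_, Finset.mem_filter.2 ⟨hpm, fun w hw => h u hu w ((hin _ hpm u hpu w).1 hw)⟩, hpu⟩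
    · rintro ⟨P, hP, huP⟩
      exact (Finset.mem_filter.1 hP).2 huP

/-- The sum of the rows over a parset lies in the lattice. -/
theorem sum_lapRow_mem {V : Type*} [Fintype V] [DecidableEq V] (C : Parcycle V) {S : Finset V}
    (hS : C.IsParset S) : ∑ j ∈ S, C.lapRow j ∈ C.laplacianLattice := by
  obtain ⟨U, hU, rfl⟩ := hS
  rw [Finset.sum_biUnion]
  · exact AddSubgroup.sum_mem _ fun P hP => AddSubgroup.subset_closure ⟨P, hU hP, rfl⟩
  · exact fun P hP Q hQ h => C.partition.disjoint (hU hP) (hU hQ) h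

/-! ## Arcs -/

/-- The vertices with positions in `[a, b)`. -/
noncomputable def arc (T : BreakSeq n) (hn : 2 ≤ n) (a b : ℕ) : Finset T.Vertex :=
  Finset.univ.filter fun u => a ≤ T.pos hn u ∧ T.pos hn u < b

theorem mem_arc (T : BreakSeq n) (hn : 2 ≤ n) {a b : ℕ} {u : T.Vertex} :
    u ∈ T.arc hn a b ↔ a ≤ T.pos hn u ∧ T.pos hn u < b := by
  simp [arc]

/-- The bounds on a and b keep positions 0 and n + k - 1 outside the arc, so the wrap-around plays
no role. -/
theorem nxt_mem_arc (T : BreakSeq n) (hn : 2 ≤ n) {a b : ℕ} (ha : 1 ≤ a) (hb : b < n + T.k)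
    {u : T.Vertex} :
    T.nxt hn u ∈ T.arc hn a b ↔ a ≤ T.pos hn u + 1 ∧ T.pos hn u + 1 < b := by
  have := T.consec_nxt hn u
  have := T.pos_lt hn u
  unfold Consec at *
  rw [mem_arc]
  omega

/-- A main vertex has at most two elements, which are then adjacent. Only the edges entering
positions a and b leave the arc, and both join distinct main vertices. -/
theorem isParset_arc (T : BreakSeq n) (hn : 2 ≤ n) {a b : ℕ} {c d : RIdx n}
    (hc : T.IsPos (.x c) a) (hd : T.IsPos (.x d) b) :
    (T.parcycle hn).IsParset (T.arc hn a b) := by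
  have ha := T.pos_x_pos hc
  have hb := T.isPos_lt hn hd
  rw [isParset_iff]
  intro u hu w huw
  by_contra hw
  rcases T.eq_or_adj_of_mainLabel_eq u w huw with rfl | hadj
  · exact hw hu
  · rw [T.cycle_adj_iff hn u w (T.isPos_pos hn u) (T.isPos_pos hn w)] at hadj
    rw [mem_arc] at hu hw
    unfold Consec at hadj
    by_cases h : T.pos hn w + 1 = T.pos hn u
    · have : T.pos hn u = a := by omega
      exact T.mainLabel_ne_of_isPos hn (this ▸ hc) h huw.symm
    · have h1 : T.pos hn u + 1 = T.pos hn w := by omega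
      have : T.pos hn w = b := by omega
      exact T.mainLabel_ne_of_isPos hn (this ▸ hd) h1 huw

theorem connected_arc (T : BreakSeq n) (hn : 2 ≤ n) {a b : ℕ} (hab : a < b) (hb : b ≤ n + T.k) :
    (T.cycle.induce (T.arc hn a b : Set T.Vertex)).Connected := by
  obtain ⟨u₀, hu₀⟩ := T.exists_pos_eq hn (m := a) (by omega)
  have hm₀ : u₀ ∈ T.arc hn a b := (T.mem_arc hn).2 (by omega)
  have key : ∀ m, ∀ (u : T.Vertex) (hu : u ∈ T.arc hn a b), T.pos hn u = a + m →
      (T.cycle.induce (T.arc hn a b : Set T.Vertex)).Reachable ⟨u₀, hm₀⟩ ⟨u, hu⟩ := by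
    intro m
    induction m with
    | zero =>
      intro u hu h
      obtain rfl : u = u₀ := T.pos_injective hn (by omega)
      exact .rfl
    | succ m ih =>
      intro u hu h
      have hu' := (T.mem_arc hn).1 hu
      obtain ⟨w, hw⟩ := T.exists_pos_eq hn (m := a + m) (by omega)
      have hwm : w ∈ T.arc hn a b := (T.mem_arc hn).2 (by omega)
      refine (ih w hwm hw).trans (SimpleGraph.Adj.reachable ?_)
      change T.cycle.Adj w u
      rw [T.cycle_adj_iff hn w u (T.isPos_pos hn w) (T.isPos_pos hn u)]
      unfold Consec
      omega
  have hall : ∀ u : (T.arc hn a b : Set T.Vertex),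
      (T.cycle.induce (T.arc hn a b : Set T.Vertex)).Reachable ⟨u₀, hm₀⟩ u := by
    rintro ⟨u, hu⟩
    have hu' := (T.mem_arc hn).1 hu
    exact key (T.pos hn u - a) u hu (by omega)
  exact { preconnected := fun u w => (hall u).symm.trans (hall w), nonempty := ⟨⟨u₀, hm₀⟩⟩ }

theorem not_sink_subset_arc (T : BreakSeq n) (hn : 2 ≤ n) {a b : ℕ} (ha : 1 ≤ a) :
    ¬ T.sinkVertex ⊆ T.arc hn a b := by
  intro h
  have h2 : (⟨.s2, .s2⟩ : T.Vertex) ∈ T.arc hn a b := h (by simp [sinkVertex])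
  have h0 : T.pos hn ⟨.s2, .s2⟩ = 0 := T.isPos_pos hn ⟨.s2, .s2⟩
  rw [mem_arc] at h2
  omega

theorem arc_eq_filter_left (T : BreakSeq n) (hn : 2 ≤ n) {a b : ℕ} (ha : 1 ≤ a) (hab : a < b)
    {w : T.Vertex} (hw : T.pos hn w = a) :
    (T.arc hn a b).filter (fun u => (T.nxt hn).symm u ∉ T.arc hn a b) = {w} := by
  ext u
  obtain ⟨v, rfl⟩ := (T.nxt hn).surjective u
  rw [Finset.mem_filter, Equiv.symm_apply_apply, Finset.mem_singleton, mem_arc, mem_arc,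
    ← (T.pos_injective hn).eq_iff, hw]
  have := T.consec_nxt hn v
  have := T.pos_lt hn v
  unfold Consec at *
  omega

theorem arc_eq_filter_right (T : BreakSeq n) (hn : 2 ≤ n) {a b : ℕ} (ha : 1 ≤ a) (hab : a < b)
    (hb : b < n + T.k) {w : T.Vertex} (hw : T.pos hn w + 1 = b) :
    (T.arc hn a b).filter (fun u => T.nxt hn u ∉ T.arc hn a b) = {w} := by
  ext u
  rw [Finset.mem_filter, Finset.mem_singleton, nxt_mem_arc T hn ha hb, mem_arc,
    ← (T.pos_injective hn).eq_iff]
  omega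

/-- Only the first vertex has its predecessor outside the arc, and only the last has its successor
outside. For a one-vertex arc u = w and the monomial is a square. -/
theorem cutMonomial_arc (K : Type*) [Field K] (T : BreakSeq n) (hn : 2 ≤ n) {a b : ℕ} (ha : 1 ≤ a)
    (hab : a < b) (hb : b < n + T.k) {u w : T.Vertex} (hu : T.pos hn u = a)
    (hw : T.pos hn w + 1 = b) :
    (T.parcycle hn).cutMonomial K (T.arc hn a b) = MvPolynomial.X u * MvPolynomial.X w := by
  classical
  have hcard : ∀ (v : T.Vertex) (inst : DecidablePred fun j => j ∉ T.arc hn a b ∧ T.cycle.Adj v j),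
      (@Finset.filter _ (fun j => j ∉ T.arc hn a b ∧ T.cycle.Adj v j) inst Finset.univ).card =
      (if (T.nxt hn).symm v ∉ T.arc hn a b then 1 else 0) +
      (if T.nxt hn v ∉ T.arc hn a b then 1 else 0) := by
    intro v inst
    have h1 : @Finset.filter _ (fun j => j ∉ T.arc hn a b ∧ T.cycle.Adj v j) inst Finset.univ =
        ({(T.nxt hn).symm v, T.nxt hn v} : Finset T.Vertex).filter (· ∉ T.arc hn a b) := by
      ext j
      simp [T.cycle_adj_iff_nxt hn, eq_comm, and_comm, or_comm]
    rw [h1, Finset.card_filter, Finset.sum_pair (T.nxt_ne_symm hn v).symm]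
  unfold Parcycle.cutMonomial
  refine (Finset.prod_congr rfl fun v _ => congrArg (MvPolynomial.X v ^ ·) (hcard v _)).trans ?_
  simp only [pow_add, Finset.prod_mul_distrib]
  simp only [pow_ite, pow_one, pow_zero]
  rw [← Finset.prod_filter, ← Finset.prod_filter, arc_eq_filter_left T hn ha hab hu,
    arc_eq_filter_right T hn ha hab hb hw, Finset.prod_singleton, Finset.prod_singleton]

/-- In `sum_lapRow` only the two edges crossing the boundary of the arc survive, with opposite
signs. -/
theorem sum_lapRow_arc (T : BreakSeq n) (hn : 2 ≤ n) {a b : ℕ} (ha : 1 ≤ a) (hab : a < b)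
    (hb : b < n + T.k) {u u' w w' : T.Vertex} (hu' : T.pos hn u' + 1 = a) (hu : T.pos hn u = a)
    (hw' : T.pos hn w' + 1 = b) (hw : T.pos hn w = b) :
    ∑ j ∈ T.arc hn a b, (T.parcycle hn).lapRow j =
      (Pi.single u 1 + Pi.single w' 1 - (Pi.single u' 1 + Pi.single w 1) : T.Vertex → ℤ) := by
  have hk := T.k_pos
  have h1 : T.nxt hn u' = u := (T.nxt_eq_iff hn _ _).2 (Or.inl (by omega))
  have h2 : T.nxt hn w' = w := (T.nxt_eq_iff hn _ _).2 (Or.inl (by omega))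
  have hne : u' ≠ w' := by rintro rfl; omega
  rw [T.sum_lapRow hn, ← Finset.sum_subset (Finset.subset_univ {u', w'}), Finset.sum_pair hne,
    h1, h2]
  · have e1 : u' ∉ T.arc hn a b := by rw [mem_arc]; omega
    have e2 : u ∈ T.arc hn a b := by rw [mem_arc]; omega
    have e3 : w' ∈ T.arc hn a b := by rw [mem_arc]; omega
    have e4 : w ∉ T.arc hn a b := by rw [mem_arc]; omega
    simp only [e1, e2, e3, e4, if_true, if_false]
    module
  · intro j _ hj
    simp only [Finset.mem_insert, Finset.mem_singleton, not_or, ← (T.pos_injective hn).eq_iff] at hj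
    have : j ∈ T.arc hn a b ↔ T.nxt hn j ∈ T.arc hn a b := by
      rw [nxt_mem_arc T hn ha hb, mem_arc]
      omega
    simp [this]

/-- A connected parset that misses the sink is an arc between two edges joining main vertices. -/
theorem exists_eq_arc (T : BreakSeq n) (hn : 2 ≤ n) {S : Finset T.Vertex}
    (hS : (T.parcycle hn).IsConnectedParset S) (hsink : ¬ T.sinkVertex ⊆ S) :
    ∃ a b, ∃ c d : RIdx n, a < b ∧ T.IsPos (.x c) a ∧ T.IsPos (.x d) b ∧ S = T.arc hn a b := by
  have hk := T.k_pos
  obtain ⟨hpar, hconn⟩ := hS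
  rw [isParset_iff] at hpar
  -- A parset meeting the sink contains it, so S avoids both end positions and cannot use the
  -- wrap-around edge.
  have hs : ∀ u ∈ S, T.pos hn u ≠ 0 ∧ T.pos hn u + 1 ≠ n + T.k := by
    intro u hu
    have hlab : T.mainLabel u.1 ≠ .s1 := by
      intro h
      apply hsink
      intro w hw
      apply hpar u hu
      rw [h]
      simp only [sinkVertex, Finset.mem_insert, Finset.mem_singleton] at hw
      rcases hw with rfl | rfl <;> rfl
    constructor
    · intro h
      apply hlab
      rw [T.isPos_inj u.2 .s2 (T.isPos_pos hn u) h]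
      rfl
    · intro h
      apply hlab
      rw [T.isPos_inj u.2 .s1 (T.isPos_pos hn u) h]
      rfl
  obtain ⟨⟨z, hz⟩⟩ := hconn.nonempty
  obtain ⟨p, hp, hpmin⟩ := S.exists_min_image (T.pos hn) ⟨z, hz⟩
  obtain ⟨q, hq, hqmax⟩ := S.exists_max_image (T.pos hn) ⟨z, hz⟩
  -- A walk inside S changes position by one at each step, so it cannot pass from below v to above v
  -- without visiting v.
  have hbetween : ∀ v : T.Vertex, T.pos hn p ≤ T.pos hn v → T.pos hn v ≤ T.pos hn q → v ∈ S := by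
    intro v h1 h2
    by_contra hv
    have hpv : T.pos hn p ≠ T.pos hn v := fun h => hv (T.pos_injective hn h ▸ hp)
    have hwalk : ∀ (x y : (S : Set T.Vertex)), (T.cycle.induce (S : Set T.Vertex)).Walk x y →
        T.pos hn x.1 < T.pos hn v → T.pos hn y.1 < T.pos hn v := by
      intro x y W
      induction W with
      | nil => exact id
      | @cons x y _ hxy _ ih =>
        intro hx
        apply ih
        have hadj : T.cycle.Adj x.1 y.1 := hxy
        rw [T.cycle_adj_iff hn _ _ (T.isPos_pos hn x.1) (T.isPos_pos hn y.1)] at hadj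
        have h3 := hs x.1 x.2
        have h4 := hs y.1 y.2
        have hyv : T.pos hn y.1 ≠ T.pos hn v := fun h => hv (T.pos_injective hn h ▸ y.2)
        unfold Consec at hadj
        omega
    obtain ⟨W⟩ := hconn.preconnected ⟨p, hp⟩ ⟨q, hq⟩
    have : T.pos hn q < T.pos hn v := hwalk _ _ W (lt_of_le_of_ne h1 hpv)
    omega
  have hpq := hpmin q hq
  have hp0 := hs p hp
  have hq0 := hs q hq
  have hqlt := T.pos_lt hn q
  obtain ⟨p', hp'⟩ := T.exists_pos_eq hn (m := T.pos hn p - 1) (by omega)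
  obtain ⟨q', hq'⟩ := T.exists_pos_eq hn (m := T.pos hn q + 1) (by omega)
  -- By extremality of p and q, the vertices just outside them are not in S. As S is a parset, the
  -- edges to them join distinct main vertices.
  obtain ⟨-, c, hc⟩ := T.exists_isPos_of_mainLabel_ne hn (u := p') (w := p)
    (Or.inl (by omega)) fun h => by have := hpmin p' (hpar p hp p' h.symm); omega
  obtain ⟨-, d, hd⟩ := T.exists_isPos_of_mainLabel_ne hn (u := q) (w := q')
    (Or.inl (by omega)) fun h => by have := hqmax q' (hpar q hq q' h); omega
  refine ⟨_, _, c, d, by omega, hc, hd, ?_⟩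
  ext v
  rw [mem_arc]
  constructor
  · intro hv
    have := hpmin v hv
    have := hqmax v hv
    omega
  · intro hv
    exact hbetween v hv.1 (by omega)

end BreakSeq

/-! ## Binomials in the ideal of the rational normal curve -/

theorem hankel_minor (K : Type*) [Field K] (n : ℕ) (v r : Finset.Icc 1 n) :
    ((hankelMatrix K n).submatrix id ![v, r]).det =
      hankelMatrix K n 0 v * hankelMatrix K n 1 r - hankelMatrix K n 0 r * hankelMatrix K n 1 v := by
  rw [Matrix.det_fin_two]
  rfl

theorem hankelMatrix_zero (K : Type*) [Field K] {n : ℕ} {v : Finset.Icc 1 n} {c : RIdx n}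
    (h : c.1 = v.1) : hankelMatrix K n 0 v = MvPolynomial.X c :=
  congrArg MvPolynomial.X (Subtype.ext h.symm)

theorem hankelMatrix_one (K : Type*) [Field K] {n : ℕ} {v : Finset.Icc 1 n} {c : RIdx n}
    (h : c.1 = v.1 + 1) : hankelMatrix K n 1 v = MvPolynomial.X c :=
  congrArg MvPolynomial.X (Subtype.ext h.symm)

theorem minor_mem_rationalNormalIdeal (K : Type*) [Field K] {n : ℕ} {p q p' q' : RIdx n}
    (hp : p'.1 = p.1 + 1) (hq : q.1 = q'.1 + 1) (hpq : p.1 < q'.1) :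
    (MvPolynomial.X p * MvPolynomial.X q - MvPolynomial.X p' * MvPolynomial.X q' : RRing K n) ∈
      rationalNormalIdeal K n := by
  have h1 := Finset.mem_Icc.1 p.2
  have h2 := Finset.mem_Icc.1 q.2
  refine Ideal.subset_span ⟨⟨p.1, Finset.mem_Icc.2 (by omega)⟩,
    ⟨q'.1, Finset.mem_Icc.2 (by omega)⟩, hpq, ?_⟩
  rw [hankel_minor, hankelMatrix_zero K (c := p) rfl, hankelMatrix_one K (c := q) hq,
    hankelMatrix_zero K (c := q') rfl, hankelMatrix_one K (c := p') hp, mul_comm (MvPolynomial.X q')]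

/-- A multiset of indices contained in some `{a, a + 1}` is determined by its cardinality and
its sum. -/
theorem eq_of_balanced {n : ℕ} {u v : RIdx n →₀ ℕ}
    (hu : ∀ p ∈ u.support, ∀ q ∈ u.support, q.1 ≤ p.1 + 1)
    (hv : ∀ p ∈ v.support, ∀ q ∈ v.support, q.1 ≤ p.1 + 1)
    (h1 : ∑ p, u p = ∑ p, v p) (h2 : ∑ p, u p * p.1 = ∑ p, v p * p.1) : u = v := by
  -- With a the least index and β the multiplicity of a + 1, the weight is a · degree + β with β <
  -- degree, as a itself occurs. Division with remainder then recovers a and β; the zero multiset is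
  -- treated apart.
  have key : ∀ w : RIdx n →₀ ℕ, (∀ p ∈ w.support, ∀ q ∈ w.support, q.1 ≤ p.1 + 1) → w ≠ 0 →
      ∃ a β : ℕ, β < ∑ p, w p ∧ ∑ p, w p * p.1 = a * (∑ p, w p) + β ∧
        ∀ p, w p = if p.1 = a then (∑ p, w p) - β else if p.1 = a + 1 then β else 0 := by
    intro w hw hw0
    obtain ⟨a, ha, hmin⟩ := w.support.exists_min_image (fun p => p.1)
      (Finsupp.support_nonempty_iff.2 hw0)
    have hz : ∀ p, w p ≠ 0 → p.1 = a.1 ∨ p.1 = a.1 + 1 := by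
      intro p hp
      have hp' := Finsupp.mem_support_iff.2 hp
      have := hmin p hp'
      have := hw a ha p hp'
      omega
    have ha' := Finsupp.mem_support_iff.1 ha
    have hsum : ∑ p, w p = w a + ∑ p, (if p.1 = a.1 + 1 then w p else 0) := by
      have : w a = ∑ p, if p = a then w p else 0 := by simp
      rw [this, ← Finset.sum_add_distrib]
      refine Finset.sum_congr rfl fun p _ => ?_
      by_cases hp : w p = 0
      · simp [hp]
      · rcases hz p hp with h | h
        · rw [if_pos (Subtype.ext h), if_neg (by omega), add_zero]
        · rw [if_neg (fun h' => by rw [h'] at h; omega), if_pos h, zero_add]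
    refine ⟨a.1, ∑ p, (if p.1 = a.1 + 1 then w p else 0), by omega, ?_, ?_⟩
    · rw [Finset.mul_sum, ← Finset.sum_add_distrib]
      refine Finset.sum_congr rfl fun p _ => ?_
      by_cases hp : w p = 0
      · simp [hp]
      · rcases hz p hp with h | h
        · rw [if_neg (by omega), h, mul_comm, add_zero]
        · rw [if_pos h, h]; ring
    · intro p
      split_ifs with h h'
      · rw [Subtype.ext h, hsum, Nat.add_sub_cancel]
      · rw [Finset.sum_eq_single p, if_pos h']
        · intro q _ hq
          exact if_neg fun hq' => hq (Subtype.ext (by omega))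
        · simp
      · by_contra hp
        have := hz p hp
        omega
  by_cases hu0 : u = 0
  · subst hu0
    ext p
    have h0 : ∑ p, v p = 0 := by rw [← h1]; simp
    exact ((Finset.sum_eq_zero_iff.1 h0) p (Finset.mem_univ p)).symm
  by_cases hv0 : v = 0
  · subst hv0
    ext p
    have h0 : ∑ p, u p = 0 := by rw [h1]; simp
    exact (Finset.sum_eq_zero_iff.1 h0) p (Finset.mem_univ p)
  obtain ⟨a, β, hβ, hW, hp⟩ := key u hu hu0
  obtain ⟨a', β', hβ', hW', hp'⟩ := key v hv hv0
  rw [← h1] at hβ' hW' hp'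
  rw [← h2] at hW'
  generalize ∑ p, u p = d at *
  generalize ∑ p, u p * p.1 = W at *
  have haa : a = a' := by
    rcases Nat.lt_trichotomy a a' with h | h | h
    · nlinarith [Nat.mul_le_mul_right d (show a + 1 ≤ a' from h)]
    · exact h
    · nlinarith [Nat.mul_le_mul_right d (show a' + 1 ≤ a from h)]
  subst haa
  obtain rfl : β = β' := by omega
  ext p
  rw [hp, hp']

/-- Monomials of the same degree and weight are congruent modulo the ideal of the rational normal
curve. -/
theorem monomial_sub_monomial_mem (K : Type*) [Field K] {n : ℕ} (u v : RIdx n →₀ ℕ)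
    (h1 : ∑ p, u p = ∑ p, v p) (h2 : ∑ p, u p * p.1 = ∑ p, v p * p.1) :
    (MvPolynomial.monomial u 1 - MvPolynomial.monomial v 1 : RRing K n) ∈
      rationalNormalIdeal K n := by
  -- If x_p x_q divides the monomial with q ≥ p + 2, it is replaced by x_{p+1} x_{q-1}. The
  -- difference is a multiple of a minor, and the sum of squared indices drops by 2(q - p - 1).
  have step : ∀ u : RIdx n →₀ ℕ, ¬ (∀ p ∈ u.support, ∀ q ∈ u.support, q.1 ≤ p.1 + 1) →
      ∃ w : RIdx n →₀ ℕ, ∑ p, w p = ∑ p, u p ∧ ∑ p, w p * p.1 = ∑ p, u p * p.1 ∧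
        ∑ p, w p * (p.1 * p.1) < ∑ p, u p * (p.1 * p.1) ∧
        (MvPolynomial.monomial u 1 - MvPolynomial.monomial w 1 : RRing K n) ∈
          rationalNormalIdeal K n := by
    intro u hu
    push Not at hu
    obtain ⟨p, hp, q, hq, hpq⟩ := hu
    have hpi := Finset.mem_Icc.1 p.2
    have hqi := Finset.mem_Icc.1 q.2
    rw [Finsupp.mem_support_iff] at hp hq
    obtain ⟨t, rfl⟩ : ∃ t, u = t + (Finsupp.single p 1 + Finsupp.single q 1) := by
      refine ⟨u - (Finsupp.single p 1 + Finsupp.single q 1), (tsub_add_cancel_of_le ?_).symm⟩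
      intro x
      simp only [Finsupp.add_apply, Finsupp.single_apply]
      have hne : p ≠ q := by rintro rfl; omega
      split_ifs with e1 e2
      · exact absurd (e1.trans e2.symm) hne
      · subst e1; omega
      · rename_i e2; subst e2; omega
      · omega
    obtain ⟨p', hp'⟩ : ∃ p' : RIdx n, p'.1 = p.1 + 1 := ⟨⟨p.1 + 1, Finset.mem_Icc.2 (by omega)⟩, rfl⟩
    obtain ⟨q', hq'⟩ : ∃ q' : RIdx n, q.1 = q'.1 + 1 :=
      ⟨⟨q.1 - 1, Finset.mem_Icc.2 (by omega)⟩, by simp only; omega⟩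
    refine ⟨t + (Finsupp.single p' 1 + Finsupp.single q' 1), ?_, ?_, ?_, ?_⟩
    · simp [Finset.sum_add_distrib, Finsupp.single_apply]
    · simp only [Finsupp.add_apply, add_mul, Finset.sum_add_distrib, Finsupp.single_apply, ite_mul,
        one_mul, zero_mul, Finset.sum_ite_eq, Finset.mem_univ, if_true]
      omega
    · simp only [Finsupp.add_apply, add_mul, Finset.sum_add_distrib, Finsupp.single_apply, ite_mul,
        one_mul, zero_mul, Finset.sum_ite_eq, Finset.mem_univ, if_true]
      rw [hp', hq']
      nlinarith
    · have := Ideal.mul_mem_left _ (MvPolynomial.monomial t (1 : K))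
        (minor_mem_rationalNormalIdeal K hp' hq' (by omega))
      rw [mul_sub] at this
      simpa [MvPolynomial.X, MvPolynomial.monomial_mul] using this
  obtain ⟨N, hN⟩ : ∃ N, ∑ p, u p * (p.1 * p.1) + ∑ p, v p * (p.1 * p.1) ≤ N := ⟨_, le_rfl⟩
  induction N using Nat.strong_induction_on generalizing u v with
  | _ N ih =>
    by_cases hu : ∀ p ∈ u.support, ∀ q ∈ u.support, q.1 ≤ p.1 + 1
    · by_cases hv : ∀ p ∈ v.support, ∀ q ∈ v.support, q.1 ≤ p.1 + 1
      · rw [eq_of_balanced hu hv h1 h2, sub_self]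
        exact Ideal.zero_mem _
      · obtain ⟨w, e1, e2, e3, hw⟩ := step v hv
        have := ih (N - 1) (by omega) u w (by omega) (by omega) (by omega)
        simpa using Ideal.sub_mem _ this hw
    · obtain ⟨w, e1, e2, e3, hw⟩ := step u hu
      have := ih (N - 1) (by omega) w v (by omega) (by omega) (by omega)
      simpa using Ideal.add_mem _ hw this

/-! ### Positions of the labels 1, …, n. -/

namespace BreakSeq

variable {n : ℕ}

theorem exists_isPos_x (T : BreakSeq n) (c : RIdx n) (hc : c.1 ≤ n) :
    ∃ f, T.IsPos (.x c) f := by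
  obtain ⟨r, hr, h1, h2⟩ := T.exists_block c.1 (Finset.mem_Icc.1 c.2).1 hc
  exact ⟨T.i r + T.i (r + 1) + r - c.1 - 1, r, hr, h1, h2, by omega⟩

/-- Here x_c need not be a vertex, so `isPos_inj` does not apply; instead the target of the vertex
at that position is both labels. -/
theorem isPos_x_inj (T : BreakSeq n) (hn : 2 ≤ n) {c d : RIdx n} {f : ℕ} (hc : T.IsPos (.x c) f)
    (hd : T.IsPos (.x d) f) : c = d := by
  obtain ⟨w, hw, hf⟩ := T.exists_vertex_of_lt hn f (T.isPos_lt hn hc)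
  rw [← T.target_eq_of_isPos hw hf hc, ← T.target_eq_of_isPos hw hf hd]

/-! ## The toppling ideal -/

/-- The binomial of an arc maps to a minor. -/
theorem minor_mem_map_topplingIdeal (K : Type*) [Field K] (T : BreakSeq n) (hn : 2 ≤ n) {a b : ℕ}
    (hab : a < b) {c d c' d' : RIdx n} (hc : T.IsPos (.x c) a) (hd : T.IsPos (.x d) b)
    (hc' : c'.1 = c.1 + 1) (hd' : d'.1 = d.1 + 1) :
    (MvPolynomial.X c * MvPolynomial.X d' - MvPolynomial.X c' * MvPolynomial.X d : RRing K n) ∈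
      (T.topplingIdeal K hn).map (T.subst K) := by
  have ha := T.pos_x_pos hc
  have hb := T.isPos_lt hn hd
  obtain ⟨u', hu'⟩ := T.exists_pos_eq hn (m := a - 1) (by omega)
  obtain ⟨u, hu⟩ := T.exists_pos_eq hn (m := a) (by omega)
  obtain ⟨w', hw'⟩ := T.exists_pos_eq hn (m := b - 1) (by omega)
  obtain ⟨w, hw⟩ := T.exists_pos_eq hn (m := b) (by omega)
  have hmem : (MvPolynomial.X u * MvPolynomial.X w' - MvPolynomial.X u' * MvPolynomial.X w :
      MvPolynomial T.Vertex K) ∈ (T.parcycle hn).topplingIdeal K := by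
    -- The exponent difference is the sum of the Laplacian rows over the arc.
    refine Ideal.subset_span ⟨Finsupp.single u 1 + Finsupp.single w' 1,
      Finsupp.single u' 1 + Finsupp.single w 1, ?_, ?_⟩
    · have h := sum_lapRow_mem _ (T.isParset_arc hn hc hd)
      rw [T.sum_lapRow_arc hn ha hab hb (u := u) (u' := u') (w := w) (w' := w') (by omega) hu
        (by omega) hw] at h
      convert h using 1
      ext x
      simp [Finsupp.single_apply, Pi.single_apply, eq_comm]
    · simp [MvPolynomial.X, MvPolynomial.monomial_mul]
  have h1 := T.target_eq_of_isPos u.2 (T.isPos_pos hn u) (hu.symm ▸ hc)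
  have h2 := T.target_eq_of_isPos w.2 (T.isPos_pos hn w) (hw.symm ▸ hd)
  have h3 := T.target_eq_succ_of_isPos hn (c := c) u'.2 (T.isPos_pos hn u')
    (by rw [hu', Nat.sub_add_cancel ha]; exact hc)
  have h4 := T.target_eq_succ_of_isPos hn (c := d) w'.2 (T.isPos_pos hn w')
    (by rw [hw', Nat.sub_add_cancel (by omega)]; exact hd)
  have := Ideal.mem_map_of_mem (T.subst K) (Ideal.mem_map_of_mem
    (MvPolynomial.rename (R := K) (Subtype.val : T.Vertex → SVar n T.k)) hmem)
  simp only [map_sub, map_mul, MvPolynomial.rename_X, T.subst_X K] at this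
  rw [h1, h2, Subtype.ext (h3.trans hc'.symm), Subtype.ext (h4.trans hd'.symm)] at this
  exact this

theorem sum_mapDomain_mul {σ τ : Type*} [Fintype σ] [Fintype τ] [DecidableEq σ] [DecidableEq τ]
    (g : σ → τ) (u : σ →₀ ℕ) (h : τ → ℕ) :
    ∑ p, u.mapDomain g p * h p = ∑ w, u w * h (g w) := by
  induction u using Finsupp.induction_linear with
  | zero => simp
  | add x y hx hy => simp only [Finsupp.mapDomain_add, Finsupp.add_apply, add_mul,
      Finset.sum_add_distrib, hx, hy]
  | single w c => simp [Finsupp.mapDomain_single, Finsupp.single_apply]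

/-- The substitution carries the toppling ideal onto the ideal of the rational normal curve. -/
theorem map_topplingIdeal (K : Type*) [Field K] (T : BreakSeq n) (hn : 2 ≤ n) :
    (T.topplingIdeal K hn).map (T.subst K) = rationalNormalIdeal K n := by
  apply le_antisymm
  · refine Ideal.map_le_iff_le_comap.2 (Ideal.map_le_iff_le_comap.2 (Ideal.span_le.2 ?_))
    rintro _ ⟨u, v, huv, rfl⟩
    change T.subst K (MvPolynomial.rename Subtype.val _) ∈ rationalNormalIdeal K n
    have hmon : ∀ u : T.Vertex →₀ ℕ, T.subst K (MvPolynomial.rename Subtype.val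
        (MvPolynomial.monomial u 1)) =
        MvPolynomial.monomial (u.mapDomain fun w => T.target w.1) 1 := by
      intro u
      rw [← MvPolynomial.rename_monomial]
      have : (T.subst K).comp (MvPolynomial.rename Subtype.val) =
          MvPolynomial.rename (R := K) fun w : T.Vertex => T.target w.1 := by
        ext w
        simp [T.subst_X K]
      exact DFunLike.congr_fun this _
    rw [map_sub, map_sub, hmon, hmon]
    have hsum : ∀ h : T.Vertex → ℕ, ∑ w, ((u w : ℤ) - v w) * h w = 0 →
        ∑ w, u w * h w = ∑ w, v w * h w := by
      intro h hh
      simp only [sub_mul, Finset.sum_sub_distrib, sub_eq_zero] at hh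
      exact_mod_cast hh
    apply monomial_sub_monomial_mem
    -- Equality of degrees: the constant function drops by 0.
    · have h := hsum (fun _ => 1)
        (T.sum_mul_eq_zero_of_mem_laplacianLattice hn _ 0 (fun _ _ => sub_self _) huv)
      have h1 := sum_mapDomain_mul (fun w : T.Vertex => T.target w.1) u fun _ => 1
      have h2 := sum_mapDomain_mul (fun w : T.Vertex => T.target w.1) v fun _ => 1
      simp only [mul_one] at h h1 h2
      rw [h1, h2, h]
    -- Equality of weights: the target drops by 1 along each edge between main vertices.
    · rw [sum_mapDomain_mul _ _ fun p : RIdx n => p.1, sum_mapDomain_mul _ _ fun p : RIdx n => p.1]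
      refine hsum _ (T.sum_mul_eq_zero_of_mem_laplacianLattice hn _ 1 (fun w hw => ?_) huv)
      have := T.target_eq_of_mainLabel_ne hn w hw
      omega
  · refine Ideal.span_le.2 ?_
    rintro _ ⟨v, r, hvr, rfl⟩
    have hvr' : v.1 < r.1 := hvr
    have hv := Finset.mem_Icc.1 v.2
    have hr := Finset.mem_Icc.1 r.2
    obtain ⟨c, hc⟩ : ∃ c : RIdx n, c.1 = v.1 := ⟨⟨v.1, Finset.mem_Icc.2 (by omega)⟩, rfl⟩
    obtain ⟨d, hd⟩ : ∃ d : RIdx n, d.1 = r.1 := ⟨⟨r.1, Finset.mem_Icc.2 (by omega)⟩, rfl⟩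
    obtain ⟨c', hc'⟩ : ∃ c : RIdx n, c.1 = v.1 + 1 := ⟨⟨v.1 + 1, Finset.mem_Icc.2 (by omega)⟩, rfl⟩
    obtain ⟨d', hd'⟩ : ∃ d : RIdx n, d.1 = r.1 + 1 := ⟨⟨r.1 + 1, Finset.mem_Icc.2 (by omega)⟩, rfl⟩
    rw [hankel_minor, hankelMatrix_zero K hc, hankelMatrix_zero K hd, hankelMatrix_one K hc',
      hankelMatrix_one K hd', mul_comm (MvPolynomial.X d)]
    obtain ⟨a, ha⟩ := T.exists_isPos_x c (by omega)
    obtain ⟨b, hb⟩ := T.exists_isPos_x d (by omega)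
    -- The arc starts at whichever label comes first in the cyclic order; the other order yields the
    -- negative of the minor.
    rcases Nat.lt_trichotomy a b with h | rfl | h
    · exact T.minor_mem_map_topplingIdeal K hn h ha hb (by omega) (by omega)
    · have := congrArg Subtype.val (T.isPos_x_inj hn ha hb)
      omega
    · have := Ideal.neg_mem_iff _ |>.2
        (T.minor_mem_map_topplingIdeal K hn h hb ha (c' := d') (d' := c') (by omega) (by omega))
      rw [neg_sub] at this
      rwa [mul_comm (MvPolynomial.X c), mul_comm (MvPolynomial.X c')]

/-! ## The parking function ideal -/

theorem map_rename_cutMonomial_arc (K : Type*) [Field K] (T : BreakSeq n) (hn : 2 ≤ n) {a b : ℕ}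
    (hab : a < b) {c d d' : RIdx n} (hc : T.IsPos (.x c) a) (hd : T.IsPos (.x d) b)
    (hd' : d'.1 = d.1 + 1) :
    T.subst K (MvPolynomial.rename Subtype.val ((T.parcycle hn).cutMonomial K (T.arc hn a b))) =
      MvPolynomial.X c * MvPolynomial.X d' := by
  have ha := T.pos_x_pos hc
  have hb := T.isPos_lt hn hd
  obtain ⟨u, hu⟩ := T.exists_pos_eq hn (m := a) (by omega)
  obtain ⟨w, hw⟩ := T.exists_pos_eq hn (m := b - 1) (by omega)
  have h1 := T.target_eq_of_isPos u.2 (T.isPos_pos hn u) (hu.symm ▸ hc)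
  have h2 := T.target_eq_succ_of_isPos hn (c := d) w.2 (T.isPos_pos hn w)
    (by rw [hw, Nat.sub_add_cancel (by omega)]; exact hd)
  rw [T.cutMonomial_arc K hn ha hab hb hu (w := w) (by omega), map_mul, map_mul,
    MvPolynomial.rename_X, MvPolynomial.rename_X, T.subst_X K, T.subst_X K, h1,
    Subtype.ext (h2.trans hd'.symm)]

/-- The substitution carries the parking function ideal onto the monomial ideal. -/
theorem map_parkingIdeal (K : Type*) [Field K] (T : BreakSeq n) (hn : 2 ≤ n) :
    (T.parkingIdeal K hn).map (T.subst K) = T.monomialIdeal K := by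
  have hl := T.i_last
  apply le_antisymm
  · refine Ideal.map_le_iff_le_comap.2 (Ideal.map_le_iff_le_comap.2 (Ideal.span_le.2 ?_))
    rintro _ ⟨S, hS, hsink, rfl⟩
    obtain ⟨a, b, c, d, hab, hc, hd, rfl⟩ := T.exists_eq_arc hn hS hsink
    have hc1 := Finset.mem_Icc.1 c.2
    have hd1 := Finset.mem_Icc.1 d.2
    have hcd := fun d' => T.map_rename_cutMonomial_arc K hn hab (d' := d') hc hd
    obtain ⟨r, hr, h1, h2, h3⟩ := hc
    obtain ⟨s, hs, h4, h5, h6⟩ := hd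
    have hcn : c.1 ≤ n := by
      have := T.i_mono (show r + 1 ≤ T.k from hr) le_rfl
      omega
    have hdn : d.1 ≤ n := by
      have := T.i_mono (show s + 1 ≤ T.k from hs) le_rfl
      omega
    change T.subst K (MvPolynomial.rename Subtype.val _) ∈ T.monomialIdeal K
    rw [hcd ⟨d.1 + 1, Finset.mem_Icc.2 (by omega)⟩ rfl]
    -- For c in an earlier block than d, the break i_{r+1} separates them: a main diagonal. In a
    -- common block labels descend, so d < c: an anti-diagonal. A later block for c contradicts a <
    -- b.
    rcases Nat.lt_trichotomy r s with h | rfl | h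
    · have := T.i_mono (show r + 1 ≤ s from h) (by omega)
      refine Ideal.subset_span (Or.inl ⟨⟨c.1, Finset.mem_Icc.2 (by omega)⟩,
        ⟨d.1, Finset.mem_Icc.2 (by omega)⟩, ?_, ⟨r + 1, hr, ?_, ?_⟩, rfl⟩)
      · exact Subtype.mk_lt_mk.2 (by omega)
      · simp only; omega
      · simp only; omega
    · refine Ideal.subset_span (Or.inr ⟨⟨d.1, Finset.mem_Icc.2 (by omega)⟩,
        ⟨c.1, Finset.mem_Icc.2 (by omega)⟩, ?_, ⟨r, hr, ?_, ?_, ?_⟩, mul_comm _ _⟩)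
      · exact Subtype.mk_lt_mk.2 (by omega)
      all_goals simp only; omega
    · have := T.i_mono (show s + 1 ≤ r from h) (by omega)
      omega
  · have key : ∀ (a b : ℕ) (c d d' : RIdx n), a < b → T.IsPos (.x c) a → T.IsPos (.x d) b →
        d'.1 = d.1 + 1 → (MvPolynomial.X c * MvPolynomial.X d' : RRing K n) ∈
          (T.parkingIdeal K hn).map (T.subst K) := by
      intro a b c d d' hab hc hd hd'
      rw [← T.map_rename_cutMonomial_arc K hn hab hc hd hd']
      have hb := T.isPos_lt hn hd
      refine Ideal.mem_map_of_mem _ (Ideal.mem_map_of_mem _ (Ideal.subset_span ⟨_, ⟨?_, ?_⟩,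
        T.not_sink_subset_arc hn (T.pos_x_pos hc), rfl⟩))
      · exact T.isParset_arc hn hc hd
      · exact T.connected_arc hn hab hb.le
    have mk : ∀ v : Finset.Icc 1 n, ∃ c c' : RIdx n, c.1 = v.1 ∧ c'.1 = v.1 + 1 := by
      intro v
      have hv := Finset.mem_Icc.1 v.2
      exact ⟨⟨v.1, Finset.mem_Icc.2 (by omega)⟩, ⟨v.1 + 1, Finset.mem_Icc.2 (by omega)⟩, rfl, rfl⟩
    refine Ideal.span_le.2 ?_
    rintro _ (⟨v, r, hvr, ⟨j, hj, h1, h2⟩, rfl⟩ | ⟨v, r, hvr, ⟨j, hj, h1, h2, h3⟩, rfl⟩)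
    · have hv := Finset.mem_Icc.1 v.2
      have hr := Finset.mem_Icc.1 r.2
      obtain ⟨c, -, hc, -⟩ := mk v
      obtain ⟨d, d', hd, hd'⟩ := mk r
      rw [hankelMatrix_zero K hc, hankelMatrix_one K hd']
      obtain ⟨a, s, hs, e1, e2, e3⟩ := T.exists_isPos_x c (by omega)
      obtain ⟨b, t, ht, e4, e5, e6⟩ := T.exists_isPos_x d (by omega)
      refine key a b c d d' ?_ ⟨s, hs, e1, e2, e3⟩ ⟨t, ht, e4, e5, e6⟩ (by omega)
      -- The break i_j lies above v and at most at r, so the block of v strictly precedes that of r,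
      -- and so do its positions.
      have hsj : s < j := by
        by_contra h
        have := T.i_mono (show j ≤ s by omega) hs.le
        omega
      have hjt : j ≤ t := by
        by_contra h
        have := T.i_mono (show t + 1 ≤ j by omega) hj
        omega
      have := T.i_mono (show s + 1 ≤ t by omega) ht.le
      omega
    · obtain ⟨c, -, hc, -⟩ := mk r
      obtain ⟨d, d', hd, hd'⟩ := mk v
      have hvr' : v.1 < r.1 := hvr
      rw [hankelMatrix_zero K hc, hankelMatrix_one K hd', mul_comm]
      -- Both labels lie in block j; these are their positions, and the larger label r comes first.
      exact key (T.i j + T.i (j + 1) + j - c.1 - 1) (T.i j + T.i (j + 1) + j - d.1 - 1) c d d'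
        (by omega) ⟨j, hj, by omega, by omega, by omega⟩ ⟨j, hj, by omega, by omega, by omega⟩
        (by omega)

/-! ## Homogeneity -/

attribute [local instance] MvPolynomial.gradedAlgebra

theorem isHomogeneous_hankelMatrix (K : Type*) [Field K] (n : ℕ) (a : Fin 2) (v : Finset.Icc 1 n) :
    (hankelMatrix K n a v).IsHomogeneous 1 := by
  fin_cases a <;> exact MvPolynomial.isHomogeneous_X _ _

theorem isHomogeneous_rationalNormalIdeal (K : Type*) [Field K] (n : ℕ) :
    (rationalNormalIdeal K n).IsHomogeneous (MvPolynomial.homogeneousSubmodule (RIdx n) K) := by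
  refine Ideal.homogeneous_span _ _ ?_
  rintro _ ⟨v, r, -, rfl⟩
  rw [hankel_minor]
  exact ⟨1 + 1, ((isHomogeneous_hankelMatrix K n 0 v).mul (isHomogeneous_hankelMatrix K n 1 r)).sub
    ((isHomogeneous_hankelMatrix K n 0 r).mul (isHomogeneous_hankelMatrix K n 1 v))⟩

theorem isHomogeneous_monomialIdeal (K : Type*) [Field K] (T : BreakSeq n) :
    (T.monomialIdeal K).IsHomogeneous (MvPolynomial.homogeneousSubmodule (RIdx n) K) := by
  refine Ideal.homogeneous_span _ _ ?_
  rintro _ (⟨v, r, -, -, rfl⟩ | ⟨v, r, -, -, rfl⟩)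
  all_goals exact ⟨1 + 1, (isHomogeneous_hankelMatrix K n _ v).mul (isHomogeneous_hankelMatrix K n _ r)⟩

end BreakSeq

theorem mainTheorem9 {K : Type*} [Field K] {n : ℕ} (hn : 2 ≤ n) (T : BreakSeq n) :
    T.InducesGradedIso K (T.topplingIdeal K hn) (rationalNormalIdeal K n) ∧
    T.InducesGradedIso K (T.parkingIdeal K hn) (T.monomialIdeal K) :=
  ⟨T.inducesGradedIso_of_map_eq (T.map_topplingIdeal K hn)
      (BreakSeq.isHomogeneous_rationalNormalIdeal K n),
    T.inducesGradedIso_of_map_eq (T.map_parkingIdeal K hn) (T.isHomogeneous_monomialIdeal K)⟩
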